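/- All graphs are simple, and $G$ is a finite graph. A planar drawing of a graph represents its vertices by distinct points of the plane and every edge $uv$ by a simple arc (a homeomorphic image of $[0,1]$) joining the points of $u$ and $v$, such that an arc contains no vertex other than its two ends and two distinct arcs meet at most in a common end. The exterior face of a drawing is the unbounded connected component of the complement of the drawing in the plane; a vertex lies on the exterior face if its point belongs to the closure of that component. A drawing is $1$-outerplanar if all vertices lie on its exterior face, and for $k\ge 2$ it is $k$-outerplanar if removing all vertices on the exterior face, together with the edges incident to them, yields a $(k-1)$-outerplanar drawing; by convention only the drawing of the graph without vertices is $0$-outerplanar. A graph is $k$-outerplanar if it admits a $k$-outerplanar planar drawing. A graph $H$ is a minor of $G$ if there are pairwise disjoint non-empty sets $\varphi(x)\subseteq V(G)$, $x\in V(H)$, each inducing a connected subgraph of $G$, such that for every edge $xy$ of $H$ some edge of $G$ joins $\varphi(x)$ and $\varphi(y)$. **Lemma.** For every integer $k\ge 0$, every minor of a $k$-outerplanar graph $G$ is $k$-outerplanar. -/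

import Mathlib

/-- A planar (crossing-free) drawing of a simple graph `G` in the Euclidean plane, which is
identified with `ℂ`. Vertices are distinct points, every edge `uv` is a simple arc joining the
points of `u` and `v`, an arc contains no vertex other than its two ends, and two different arcs
meet at most in a common end. -/
structure PlaneDrawing {V : Type*} (G : SimpleGraph V) where
  /-- the point representing a vertex -/
  pos : V → ℂ
  /-- the arc (as a set of points, including its ends) representing an edge -/
  arc : G.edgeSet → Set ℂ
  pos_injective : Function.Injective pos
  exists_path : ∀ (u v : V) (h : G.Adj u v),
    ∃ γ : Path (pos u) (pos v), Function.Injective γ ∧ Set.range γ = arc ⟨s(u, v), h⟩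
  vertex_mem_arc : ∀ (w : V) (e : G.edgeSet), pos w ∈ arc e → w ∈ (e : Sym2 V)
  arc_inter : ∀ e f : G.edgeSet, e ≠ f → ∀ z ∈ arc e ∩ arc f,
    ∃ w : V, w ∈ (e : Sym2 V) ∧ w ∈ (f : Sym2 V) ∧ z = pos w

/-- The exterior face of a (bounded) subset `X` of the plane: the union of the unbounded connected
components of the complement of `X`. For compact `X` there is exactly one such component. -/
def exteriorFace (X : Set ℂ) : Set ℂ :=
  {z | z ∉ X ∧ ¬ Bornology.IsBounded (connectedComponentIn Xᶜ z)}

namespace PlaneDrawing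

variable {V : Type*} {G : SimpleGraph V}

/-- The set of points of the drawing of the induced subgraph `G[S]` that is obtained from `D` by
removing all vertices outside `S` and all edges incident to them. -/
def points (D : PlaneDrawing G) (S : Set V) : Set ℂ :=
  D.pos '' S ∪ ⋃ e ∈ {e : G.edgeSet | ∀ w ∈ (e : Sym2 V), w ∈ S}, D.arc e

/-- The vertices of `G[S]` that lie on (the boundary of) the exterior face of the drawing of
`G[S]` induced by `D`. -/
def exteriorVertices (D : PlaneDrawing G) (S : Set V) : Set V :=
  {v | v ∈ S ∧ D.pos v ∈ closure (exteriorFace (D.points S))}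

/-- The drawing of `G[S]` induced by `D` is `k`-outerplanar. Only the drawing without vertices is
`0`-outerplanar, and a drawing is `(k + 1)`-outerplanar if removing all vertices on its exterior
face yields a `k`-outerplanar drawing. In particular it is `1`-outerplanar if and only if all its
vertices lie on the exterior face. -/
def IsKOuterplanarOn (D : PlaneDrawing G) : ℕ → Set V → Prop
  | 0, S => S = ∅
  | k + 1, S => D.IsKOuterplanarOn k (S \ D.exteriorVertices S)

/-- The drawing `D` of the whole graph `G` is `k`-outerplanar. -/
def IsKOuterplanar (D : PlaneDrawing G) (k : ℕ) : Prop :=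
  D.IsKOuterplanarOn k Set.univ

end PlaneDrawing

namespace SimpleGraph

/-- A graph is `k`-outerplanar if it admits a `k`-outerplanar planar drawing. -/
def IsKOuterplanar {V : Type*} (G : SimpleGraph V) (k : ℕ) : Prop :=
  ∃ D : PlaneDrawing G, D.IsKOuterplanar k

/-- `H` is a minor of `G`: there is a minor model of `H` in `G`, that is, a family of pairwise
disjoint (nonempty) connected vertex sets of `G`, one for each vertex of `H`, such that for every
edge `xy` of `H` some edge of `G` joins the sets of `x` and `y`. -/
def IsMinorOf {W V : Type*} (H : SimpleGraph W) (G : SimpleGraph V) : Prop :=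
  ∃ φ : W → Set V,
    (∀ x, (G.induce (φ x)).Connected) ∧
    (∀ x y, x ≠ y → Disjoint (φ x) (φ y)) ∧
    (∀ x y, H.Adj x y → ∃ u ∈ φ x, ∃ v ∈ φ y, G.Adj u v)

end SimpleGraph

/-! Induct on the number of vertices of $G$. If some branch set contains an edge $uv$, contract it;
otherwise all branch sets are singletons and $H$ is isomorphic to a subgraph of $G$. In both cases a
drawing of the new graph is the image of a drawing of $G$ under a proper continuous map of the plane
that shrinks each branch set to a point and is injective elsewhere (`BranchCollapse`). Such a map
sends an unbounded connected set off the old drawing to an unbounded connected set off the new one.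
Exterior vertices thus stay exterior, and a vertex of $H$ is peeled off no later than the first
vertex of its branch set (`BranchCollapse.isKOuterplanarOn`).

The topological content is `exists_collapse`: an arc $K$ can be collapsed to a point. With $0 \in
K$, inversion turns the complement of $K$ in the sphere into a plane domain $\Omega \ni 0$. A
Riemann map $f:\Omega\to\mathbb D$ then gives the collapse $z \mapsto (1-|f(1/z)|)/f(1/z)$ off $K$,
extended by $0$ on $K$.

Koebe's proof of the Riemann mapping theorem needs only square roots of injective nonvanishing
holomorphic $g$ on $\Omega$. These come from continuous logarithms. By Eilenberg's criterion an arc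
does not separate a bounded connected open set containing it, so $\Omega$ is exhausted by compact
sets $L$ with $\Omega\setminus L$ connected. Then $g(L)$ does not enclose $0$, and $g$ has a
logarithm on $L$. -/

open Complex Metric Set Filter Topology

/-! ### Continuous logarithms and separation of the plane -/

/-- `f` has a continuous logarithm on `X`. -/
def HasContLog (f : ℂ → ℂ) (X : Set ℂ) : Prop :=
  ∃ l : ℂ → ℂ, ContinuousOn l X ∧ ∀ z ∈ X, exp (l z) = f z

namespace HasContLog

variable {f g : ℂ → ℂ} {X Y : Set ℂ}

lemma mono (h : HasContLog f X) (hY : Y ⊆ X) : HasContLog f Y := by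
  obtain ⟨l, hl, he⟩ := h
  exact ⟨l, hl.mono hY, fun z hz ↦ he z (hY hz)⟩

lemma congr (h : HasContLog f X) (hfg : ∀ z ∈ X, f z = g z) : HasContLog g X := by
  obtain ⟨l, hl, he⟩ := h
  exact ⟨l, hl, fun z hz ↦ (he z hz).trans (hfg z hz)⟩

lemma mul (hf : HasContLog f X) (hg : HasContLog g X) : HasContLog (fun z ↦ f z * g z) X := by
  obtain ⟨l, hl, he⟩ := hf
  obtain ⟨m, hm, hn⟩ := hg
  exact ⟨fun z ↦ l z + m z, hl.add hm, fun z hz ↦ by rw [exp_add, he z hz, hn z hz]⟩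

lemma inv (hf : HasContLog f X) : HasContLog (fun z ↦ (f z)⁻¹) X := by
  obtain ⟨l, hl, he⟩ := hf
  exact ⟨fun z ↦ -l z, hl.neg, fun z hz ↦ by rw [exp_neg, he z hz]⟩

lemma const {c : ℂ} (hc : c ≠ 0) : HasContLog (fun _ ↦ c) X :=
  ⟨fun _ ↦ log c, continuousOn_const, fun _ _ ↦ exp_log hc⟩

lemma of_slitPlane (hf : ContinuousOn f X) (h : ∀ z ∈ X, f z ∈ slitPlane) : HasContLog f X :=
  ⟨fun z ↦ log (f z), hf.clog h, fun z hz ↦ exp_log (slitPlane_ne_zero (h z hz))⟩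

lemma union_of_disjoint (hX : IsClosed X) (hY : IsClosed Y) (h : Disjoint X Y)
    (hfX : HasContLog f X) (hfY : HasContLog f Y) : HasContLog f (X ∪ Y) := by
  classical
  obtain ⟨l, hl, he⟩ := hfX
  obtain ⟨m, hm, hn⟩ := hfY
  have hX' : EqOn (X.piecewise l m) l X := fun z hz ↦ by simp [hz]
  have hY' : EqOn (X.piecewise l m) m Y := fun z hz ↦ by
    simp [Set.disjoint_right.mp h hz]
  refine ⟨X.piecewise l m, (hl.congr hX').union_of_isClosed (hm.congr hY') hX hY, ?_⟩
  rintro z (hz | hz)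
  · rw [hX' hz, he z hz]
  · rw [hY' hz, hn z hz]

lemma comp {φ : ℂ → ℂ} (h : HasContLog f Y) (hφ : ContinuousOn φ X) (hm : MapsTo φ X Y) :
    HasContLog (fun z ↦ f (φ z)) X := by
  obtain ⟨l, hl, he⟩ := h
  exact ⟨l ∘ φ, hl.comp hφ hm, fun z hz ↦ he _ (hm hz)⟩

end HasContLog

lemma eq_of_exp_eq {A : Type*} [TopologicalSpace A] [PreconnectedSpace A] {g₁ g₂ : A → ℂ}
    (h₁ : Continuous g₁) (h₂ : Continuous g₂) (h : ∀ a, exp (g₁ a) = exp (g₂ a)) (a : A)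
    (ha : g₁ a = g₂ a) : g₁ = g₂ :=
  isCoveringMap_exp.eq_of_comp_eq h₁ h₂ (funext fun a ↦ Subtype.ext (h a)) a ha

/-- Along one turn of the circle a logarithm would gain $2\pi i$, although the circle returns to its
start. -/
lemma not_hasContLog_sub_sphere (p : ℂ) {R : ℝ} (hR : 0 < R) :
    ¬ HasContLog (fun z ↦ z - p) (sphere p R) := by
  rintro ⟨l, hl, he⟩
  have hmem : ∀ t : ℝ, circleMap p R t ∈ sphere p R := fun t ↦ circleMap_mem_sphere p hR.le t
  have key := eq_of_exp_eq (A := ℝ) (g₁ := fun t ↦ l (circleMap p R t))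
    (g₂ := fun t ↦ l (circleMap p R 0) + t * I)
    (hl.comp_continuous (continuous_circleMap p R) hmem) (by fun_prop)
    (fun t ↦ by
      rw [exp_add, he _ (hmem t), he _ (hmem 0)]
      simp [circleMap]) 0 (by simp)
  have h2 := congrFun key (2 * Real.pi)
  have h3 : circleMap p R (2 * Real.pi) = circleMap p R 0 := by simp [circleMap]
  simp only [h3, left_eq_add] at h2
  simp [Real.pi_ne_zero] at h2

/-- Easy half of Eilenberg's criterion. -/
lemma hasContLog_div_of_isPreconnected {N X : Set ℂ} (hN : IsOpen N) (hc : IsPreconnected N)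
    (hd : Disjoint X N) {p q : ℂ} (hp : p ∈ N) (hq : q ∈ N) :
    HasContLog (fun z ↦ (z - p) / (z - q)) X := by
  have hne : ∀ z ∈ X, ∀ r ∈ N, z - r ≠ 0 := fun z hz r hr h ↦
    Set.disjoint_left.mp hd hz (by rwa [sub_eq_zero.mp h])
  -- The relation in $(p,q)$ is symmetric and transitive. It holds for nearby points because the
  -- quotient is then within distance $1$ of $1$. Connectedness of $N$ does the rest.
  refine hc.induction₂ (fun p q ↦ HasContLog (fun z ↦ (z - p) / (z - q)) X) ?_ ?_ ?_ hp hq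
  · intro x hx
    obtain ⟨ε, hε, hb⟩ := Metric.isOpen_iff.mp hN x hx
    filter_upwards [mem_nhdsWithin_of_mem_nhds (ball_mem_nhds x hε)] with y hy
    have : HasContLog (fun z ↦ (z - y) / (z - x)) X := by
      refine HasContLog.of_slitPlane ?_ ?_
      · exact ContinuousOn.div (by fun_prop) (by fun_prop) fun z hz ↦ hne z hz x hx
      · intro z hz
        have h1 : (z - y) / (z - x) = 1 + (x - y) / (z - x) := by
          field_simp [hne z hz x hx]
          ring
        rw [h1]
        refine mem_slitPlane_of_norm_lt_one ?_
        have h2 : ε ≤ ‖z - x‖ := by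
          by_contra! h
          exact Set.disjoint_left.mp hd hz (hb (by simpa [dist_eq_norm] using h))
        rw [norm_div, div_lt_one (hε.trans_le h2)]
        refine lt_of_lt_of_le ?_ h2
        rwa [mem_ball, dist_comm, dist_eq_norm] at hy
    exact this.inv.congr fun z _ ↦ inv_div _ _
  · intro x y z _ hy _ h1 h2
    refine (h1.mul h2).congr fun w hw ↦ ?_
    field_simp [hne w hw y hy]
  · intro x y _ _ h
    exact h.inv.congr fun z _ ↦ inv_div _ _

/-- A nonvanishing function on an arc has a continuous logarithm. -/
lemma hasContLog_of_arc {a b : ℂ} (γ : Path a b) (hγ : Function.Injective γ) {f : ℂ → ℂ}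
    (hf : ContinuousOn f (range γ)) (h0 : ∀ z ∈ range γ, f z ≠ 0) : HasContLog f (range γ) := by
  have hemb : IsClosedEmbedding γ := γ.continuous.isClosedEmbedding hγ
  let c : C(unitInterval, {z : ℂ // z ≠ 0}) :=
    ⟨fun t ↦ ⟨f (γ t), h0 _ (mem_range_self t)⟩,
      (hf.comp_continuous γ.continuous mem_range_self).subtype_mk _⟩
  -- Lift the path $f\circ\gamma$ through $\exp$, then carry the lift back along the homeomorphism
  -- of $[0,1]$ onto the arc.
  obtain ⟨Γ, hΓ, -⟩ := isCoveringMap_exp.exists_path_lifts c (log (f (γ 0)))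
    (Subtype.ext (exp_log (h0 _ (mem_range_self 0))).symm)
  let e := hemb.isEmbedding.toHomeomorph
  refine ⟨fun z ↦ Γ (Function.invFun γ z), ?_, ?_⟩
  · rw [continuousOn_iff_continuous_domRestrict]
    have : (range γ).domRestrict (fun z ↦ Γ (Function.invFun γ z)) = Γ ∘ e.symm := by
      funext ⟨z, t, ht⟩
      subst ht
      have : e.symm ⟨γ t, t, rfl⟩ = t := e.symm_apply_apply t
      have h2 : Function.invFun γ (γ t) = t := Function.leftInverse_invFun hγ t
      simp [h2, this]
    rw [this]
    exact Γ.continuous.comp e.symm.continuous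
  · rintro _ ⟨t, rfl⟩
    have h2 : Function.invFun γ (γ t) = t := Function.leftInverse_invFun hγ t
    beta_reduce
    rw [h2]
    exact congrArg Subtype.val (congrFun hΓ t)

/-- A continuous nonvanishing function on the plane has a logarithm. -/
lemma hasContLog_univ {f : ℂ → ℂ} (hf : Continuous f) (h0 : ∀ z, f z ≠ 0) :
    HasContLog f univ := by
  obtain ⟨F, ⟨-, hF⟩, -⟩ := isCoveringMap_exp.existsUnique_continuousMap_lifts
    (⟨fun z ↦ ⟨f z, h0 z⟩, hf.subtype_mk _⟩ : C(ℂ, {z : ℂ // z ≠ 0})) 0 (log (f 0))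
    (Subtype.ext (exp_log (h0 0)))
  exact ⟨F, F.continuous.continuousOn, fun z _ ↦ congrArg Subtype.val (congrFun hF z)⟩

/-- Hard half of Eilenberg's criterion. -/
lemma not_separated_of_hasContLog {C P Q : Set ℂ} (hC : IsClosed C) (hP : IsOpen P) (hQ : IsOpen Q)
    (hPQ : Disjoint P Q) (hcov : P ∪ Q = Cᶜ) (hb : Bornology.IsBounded P) {p q : ℂ} (hp : p ∈ P)
    (hq : q ∈ Q) : ¬ HasContLog (fun z ↦ (z - p) / (z - q)) C := by
  classical
  rintro ⟨l, hl, he⟩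
  obtain ⟨g, hg⟩ := ContinuousMap.exists_restrict_eq hC ⟨C.domRestrict l, hl.domRestrict⟩
  have hgl : ∀ z ∈ C, g z = l z := fun z hz ↦ congr($hg ⟨z, hz⟩)
  have hpC : p ∉ C := by
    have : p ∈ Cᶜ := hcov ▸ Or.inl hp
    exact this
  have hqC : q ∉ C := by
    have : q ∈ Cᶜ := hcov ▸ Or.inr hq
    exact this
  -- Here $g$ is a Tietze extension of the logarithm, so the two formulas agree on $C$. Hence $h$ is
  -- continuous and nonvanishing on the plane and has a logarithm; but on a large circle around $P$
  -- it equals $z-p$, which has none.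
  let h : ℂ → ℂ := P.piecewise (fun z ↦ (z - q) * exp (g z)) (fun z ↦ z - p)
  have hQP : Qᶜ = P ∪ C := by
    ext z
    have h1 := Set.ext_iff.mp hcov z
    have h2 : z ∈ P → z ∉ Q := fun h ↦ Set.disjoint_left.mp hPQ h
    simp only [mem_union, mem_compl_iff] at h1 ⊢
    tauto
  have hA : EqOn h (fun z ↦ (z - q) * exp (g z)) Qᶜ := by
    rw [hQP]
    rintro z (hz | hz)
    · simp [h, hz]
    · have hzP : z ∉ P := fun hz' ↦ by
        have : z ∈ Cᶜ := hcov ▸ Or.inl hz'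
        exact this hz
      simp only [h, piecewise_eq_of_notMem _ _ _ hzP]
      rw [hgl z hz, he z hz, mul_div_cancel₀]
      rw [sub_ne_zero]
      rintro rfl
      exact hqC hz
  have hB : EqOn h (fun z ↦ z - p) Pᶜ := fun z hz ↦ by
    simp [h, piecewise_eq_of_notMem _ _ _ hz]
  have hcont : Continuous h := by
    rw [← continuousOn_univ]
    have : (univ : Set ℂ) = Qᶜ ∪ Pᶜ := by
      rw [← compl_inter, hPQ.symm.inter_eq, compl_empty]
    rw [this]
    refine ContinuousOn.union_of_isClosed ?_ ?_ hQ.isClosed_compl hP.isClosed_compl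
    · exact ContinuousOn.congr (by fun_prop) hA
    · exact ContinuousOn.congr (by fun_prop) hB
  have hne : ∀ z, h z ≠ 0 := by
    intro z
    by_cases hz : z ∈ P
    · rw [hA (Set.disjoint_left.mp hPQ hz)]
      refine mul_ne_zero (sub_ne_zero.mpr ?_) (exp_ne_zero _)
      rintro rfl
      exact Set.disjoint_left.mp hPQ hz hq
    · rw [hB hz, sub_ne_zero]
      rintro rfl
      exact hz hp
  obtain ⟨R, hR⟩ := hb.subset_ball p
  have hR0 : 0 < R := by
    have := hR hp
    rw [mem_ball, dist_self] at this
    exact this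
  refine not_hasContLog_sub_sphere p hR0 (((hasContLog_univ hcont hne).mono (subset_univ _)).congr
    fun z hz ↦ hB fun hzP ↦ ?_)
  have h1 := hR hzP
  rw [mem_ball, (mem_sphere.mp hz)] at h1
  exact lt_irrefl _ h1

/-- An arc does not separate a bounded connected open set containing it. -/
lemma isPreconnected_diff_arc {a b : ℂ} (γ : Path a b) (hγ : Function.Injective γ) {N : Set ℂ}
    (hN : IsOpen N) (hc : IsPreconnected N) (hb : Bornology.IsBounded N) (hK : range γ ⊆ N) :
    IsPreconnected (N \ range γ) := by
  have hKc : IsClosed (range γ) := (isCompact_range γ.continuous).isClosed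
  have hO : IsOpen (N \ range γ) := hN.sdiff hKc
  rw [isPreconnected_iff_subset_of_disjoint]
  intro u v hu hv hcov hdis
  by_contra! hcon
  obtain ⟨⟨q, hqO, hqu⟩, ⟨p, hpO, hpv⟩⟩ := not_subset.mp hcon.1, not_subset.mp hcon.2
  have hqv : q ∈ v := (hcov hqO).resolve_left hqu
  have hpu : p ∈ u := (hcov hpO).resolve_right hpv
  set O := N \ range γ
  -- The closed set $O^c$ is the disjoint union of the arc, where lifting gives a logarithm, and
  -- $N^c$, where one exists because $p$ and $q$ lie in the connected set $N$.
  refine not_separated_of_hasContLog (C := Oᶜ) (P := O ∩ u) (Q := O ∩ v) hO.isClosed_compl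
    (hO.inter hu) (hO.inter hv) ?_ ?_ (hb.subset (inter_subset_left.trans sdiff_subset)) ⟨hpO, hpu⟩
    ⟨hqO, hqv⟩ ?_
  · rw [Set.disjoint_left]
    rintro z ⟨hz, hzu⟩ ⟨-, hzv⟩
    have : z ∈ O ∩ (u ∩ v) := ⟨hz, hzu, hzv⟩
    rw [hdis] at this
    exact this
  · rw [← inter_union_distrib_left, compl_compl, inter_eq_left]
    exact hcov
  · have : Oᶜ = range γ ∪ Nᶜ := by
      simp [O, sdiff_eq, compl_inter, union_comm]
    rw [this]
    refine HasContLog.union_of_disjoint hKc hN.isClosed_compl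
      (Set.disjoint_compl_right_iff_subset.mpr hK) ?_ ?_
    · have hne : ∀ r ∈ O, ∀ z ∈ range γ, z - r ≠ 0 := by
        intro r hr z hz h
        rw [sub_eq_zero] at h
        exact hr.2 (h ▸ hz)
      exact hasContLog_of_arc γ hγ
        (ContinuousOn.div (by fun_prop) (by fun_prop) (hne q hqO))
        fun z hz ↦ div_ne_zero (hne p hpO z hz) (hne q hqO z hz)
    · exact hasContLog_div_of_isPreconnected hN hc disjoint_compl_left hpO.1 hqO.1

/-- Any two points of the complement lie, together with the arc, in a large ball, where the bounded
case applies. -/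
lemma isPreconnected_compl_arc {a b : ℂ} (γ : Path a b) (hγ : Function.Injective γ) :
    IsPreconnected (range γ)ᶜ := by
  refine isPreconnected_of_forall_pair fun x hx y hy ↦ ?_
  obtain ⟨R, hR⟩ := ((isCompact_range γ.continuous).isBounded.union
    ((finite_singleton x).isBounded.union (finite_singleton y).isBounded)).subset_ball 0
  refine ⟨ball 0 R \ range γ, fun z hz ↦ hz.2, ⟨hR (by simp), hx⟩, ⟨hR (by simp), hy⟩, ?_⟩
  exact isPreconnected_diff_arc γ hγ isOpen_ball (convex_ball 0 R).isPreconnected isBounded_ball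
    (subset_union_left.trans hR)

/-- Logarithms on compact subsets of a connected open set glue. -/
lemma hasContLog_of_forall_isCompact {U : Set ℂ} (hU : IsOpen U) (hc : IsPreconnected U)
    {f : ℂ → ℂ} (hf : ContinuousOn f U) (h0 : ∀ z ∈ U, f z ≠ 0)
    (h : ∀ C ⊆ U, IsCompact C → HasContLog f C) : HasContLog f U := by
  classical
  rcases U.eq_empty_or_nonempty with rfl | hne
  · exact ⟨fun _ ↦ 0, continuousOn_empty _, fun z hz ↦ hz.elim⟩
  have hpc := isPathConnected_iff_pathConnectedSpace.mp (hU.isConnected_iff_isPathConnected.mp ⟨hne, hc⟩)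
  have hlpc := hU.locallyPathConnectedSpace
  obtain ⟨a, ha⟩ := hne
  let c : C(U, {z : ℂ // z ≠ 0}) :=
    ⟨fun z ↦ ⟨f z, h0 _ z.2⟩, (continuousOn_iff_continuous_domRestrict.mp hf).subtype_mk _⟩
  obtain ⟨F, ⟨-, hF⟩, -⟩ := isCoveringMap_exp.isLocalHomeomorph.existsUnique_continuousMap_lifts c
    ⟨a, ha⟩ (log (f a)) (Subtype.ext (exp_log (h0 a ha)))
    (fun γ hγ ↦ by
      obtain ⟨Γ, h1, h2⟩ := isCoveringMap_exp.exists_path_lifts (c.comp γ) (log (f a))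
        (Subtype.ext (by simp only [hγ, ContinuousMap.comp_apply, exp_log (h0 a ha)]; rfl))
      exact ⟨Γ, h2, h1⟩)
    -- Monodromy: both paths lie in one compact set with a logarithm $l$, and each lift is $l$ along
    -- its path plus the same constant.
    (fun γ γ' Γ Γ' g0 g0' G0 G0' hΓ hΓ' h1 ↦ by
      obtain ⟨l, hl, he⟩ := h ((Subtype.val ∘ γ) '' univ ∪ (Subtype.val ∘ γ') '' univ)
        (by
          rintro _ (⟨t, -, rfl⟩ | ⟨t, -, rfl⟩)
          · exact (γ t).2
          · exact (γ' t).2)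
        ((isCompact_univ.image (by fun_prop)).union (isCompact_univ.image (by fun_prop)))
      have key : ∀ (δ : C(unitInterval, U)) (Δ : C(unitInterval, ℂ)), δ 0 = ⟨a, ha⟩ →
          Δ 0 = log (f a) →
          (fun z : ℂ ↦ (⟨_, z.exp_ne_zero⟩ : {z : ℂ // z ≠ 0})) ∘ Δ = c.comp δ →
          (∀ t, (δ t : ℂ) ∈ (Subtype.val ∘ γ) '' univ ∪ (Subtype.val ∘ γ') '' univ) →
          Δ 1 = l (δ 1) + (log (f a) - l a) := by
        intro δ Δ d0 D0 hΔ hm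
        refine congrFun (eq_of_exp_eq (g₁ := Δ) (g₂ := fun t ↦ l (δ t) + (log (f a) - l a))
          Δ.continuous ?_ ?_ 0 (by rw [D0, d0]; ring)) 1
        · exact (hl.comp_continuous (by fun_prop) hm).add continuous_const
        · intro t
          have h3 : exp (Δ t) = f (δ t) := congrArg Subtype.val (congrFun hΔ t)
          have h4 : exp (l a) = f a := by
            have := he _ (hm 0)
            rwa [d0] at this
          rw [h3, exp_add, he _ (hm t), exp_sub, exp_log (h0 a ha), h4, div_self (h0 a ha), mul_one]
      rw [key γ Γ g0 G0 hΓ fun t ↦ Or.inl ⟨t, trivial, rfl⟩,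
        key γ' Γ' g0' G0' hΓ' fun t ↦ Or.inr ⟨t, trivial, rfl⟩, h1])
  refine ⟨fun z ↦ if hz : z ∈ U then F ⟨z, hz⟩ else 0, ?_, fun z hz ↦ ?_⟩
  · rw [continuousOn_iff_continuous_domRestrict]
    convert F.continuous using 1
    funext z
    simp
  · simp only [hz, dif_pos]
    exact congrArg Subtype.val (congrFun hF ⟨z, hz⟩)

/-- The identity has a logarithm on a compact set whose complement does not enclose `0`. -/
lemma hasContLog_id_of_not_isBounded {L : Set ℂ} (hL : IsCompact L)
    (h0 : ¬ Bornology.IsBounded (connectedComponentIn Lᶜ 0)) : HasContLog (fun z ↦ z) L := by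
  obtain ⟨R, hR⟩ := hL.isBounded.subset_ball 0
  -- With $q$ in the component of $0$ and beyond $L$, factor $z = \frac{z}{z-q}\,(1-\frac
  -- zq)\,(-q)$. The `1` in the maximum only serves to make $q \ne 0$.
  have hex : ∃ q ∈ connectedComponentIn Lᶜ 0, max R 1 ≤ ‖q‖ := by
    by_contra! hcon
    exact h0 ((isBounded_ball (x := (0 : ℂ)) (r := max R 1)).subset fun q hq ↦ by
      simpa using hcon q hq)
  obtain ⟨q, hq, hqR⟩ := hex
  have h0L : (0 : ℂ) ∈ Lᶜ := by
    by_contra h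
    rw [connectedComponentIn_eq_empty h] at hq
    exact hq
  have hq0 : q ≠ 0 := by
    rintro rfl
    have := (le_max_right R 1).trans hqR
    simp at this
    linarith
  have hlt : ∀ z ∈ L, ‖z‖ < ‖q‖ := fun z hz ↦ by
    have := hR hz
    rw [mem_ball_zero_iff] at this
    exact this.trans_le ((le_max_left R 1).trans hqR)
  have h1 := hasContLog_div_of_isPreconnected (X := L) hL.isClosed.isOpen_compl.connectedComponentIn
    isPreconnected_connectedComponentIn (Set.disjoint_left.mpr fun z hz hz' ↦
      connectedComponentIn_subset _ _ hz' hz) (mem_connectedComponentIn h0L) hq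
  have h2 : HasContLog (fun z ↦ 1 + -z / q) L := by
    refine HasContLog.of_slitPlane (by fun_prop) fun z hz ↦ mem_slitPlane_of_norm_lt_one ?_
    rw [norm_div, norm_neg, div_lt_one (norm_pos_iff.mpr hq0)]
    exact hlt z hz
  refine ((h1.mul h2).mul (HasContLog.const (neg_ne_zero.mpr hq0))).congr fun z hz ↦ ?_
  have hzq : z - q ≠ 0 := by
    rw [sub_ne_zero]
    rintro rfl
    exact lt_irrefl _ (hlt z hz)
  field_simp
  ring

/-! ### Logarithms on the complement of an arc in the sphere -/

/-- The domain in the sphere complementary to an arc through `0`, in the chart at infinity. -/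
def invCompl (K : Set ℂ) : Set ℂ := {w | w = 0 ∨ w⁻¹ ∉ K}

lemma isOpen_invCompl {K : Set ℂ} (hK : IsCompact K) : IsOpen (invCompl K) := by
  rw [isOpen_iff_mem_nhds]
  intro w hw
  by_cases h0 : w = 0
  · subst h0
    obtain ⟨R, hR0, hR⟩ := hK.isBounded.subset_ball_lt 0 0
    filter_upwards [ball_mem_nhds (0 : ℂ) (inv_pos.mpr hR0)] with z hz
    by_cases hz0 : z = 0
    · exact Or.inl hz0
    · refine Or.inr fun h ↦ ?_
      have h1 := hR h
      rw [mem_ball_zero_iff] at h1 hz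
      rw [norm_inv] at h1
      exact lt_asymm hz ((inv_lt_comm₀ (norm_pos_iff.mpr hz0) hR0).mp h1)
  · have h1 : w⁻¹ ∈ Kᶜ := hw.resolve_left h0
    filter_upwards [(continuousAt_inv₀ h0).preimage_mem_nhds (hK.isClosed.isOpen_compl.mem_nhds h1)]
      with z hz
    exact Or.inr hz

lemma invCompl_eq (K : Set ℂ) : invCompl K = insert 0 (Inv.inv '' Kᶜ) := by
  ext w
  simp [invCompl]

lemma isPreconnected_inv_image {S : Set ℂ} (hS : IsPreconnected S) (h0 : (0 : ℂ) ∉ S) :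
    IsPreconnected (Inv.inv '' S) :=
  hS.image _ (continuousOn_inv₀.mono fun _ hz h ↦ h0 (h ▸ hz))

lemma isPreconnected_invCompl {K : Set ℂ} (hK : IsCompact K) (h0 : (0 : ℂ) ∈ K)
    (hc : IsPreconnected Kᶜ) : IsPreconnected (invCompl K) := by
  rw [invCompl_eq K]
  refine (isPreconnected_inv_image hc (by simpa using h0)).subset_closure (subset_insert _ _) ?_
  refine insert_subset ?_ subset_closure
  rw [mem_closure_iff_nhds]
  intro t ht
  obtain ⟨z, hz, hz0⟩ : ∃ z ∈ t ∩ invCompl K, z ≠ 0 := by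
    have h1 : t ∩ invCompl K ∈ 𝓝 (0 : ℂ) :=
      inter_mem ht ((isOpen_invCompl hK).mem_nhds (Or.inl rfl))
    have h2 : ∀ᶠ z in 𝓝[≠] (0 : ℂ), z ∈ t ∩ invCompl K := mem_nhdsWithin_of_mem_nhds h1
    obtain ⟨z, hz⟩ := (h2.and self_mem_nhdsWithin).exists
    exact ⟨z, hz.1, hz.2⟩
  exact ⟨z, hz.1, z⁻¹, hz.2.resolve_left hz0, inv_inv z⟩

lemma isPreconnected_thickening {K : Set ℂ} (hK : IsPreconnected K) {ε : ℝ} (hε : 0 < ε) :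
    IsPreconnected (thickening ε K) := by
  refine isPreconnected_of_forall_pair fun x hx y hy ↦ ?_
  obtain ⟨a, ha, hxa⟩ := mem_thickening_iff.mp hx
  obtain ⟨b, hb, hyb⟩ := mem_thickening_iff.mp hy
  refine ⟨(ball a ε ∪ K) ∪ ball b ε, union_subset (union_subset (ball_subset_thickening ha _)
    (self_subset_thickening hε K)) (ball_subset_thickening hb _), Or.inl (Or.inl hxa),
    Or.inr hyb, ?_⟩
  exact ((convex_ball a ε).isPreconnected.union a (mem_ball_self hε) ha hK).union b (Or.inr hb)
    (mem_ball_self hε) (convex_ball b ε).isPreconnected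

lemma IsClopen.not_isBounded {A : Set ℂ} (hA : IsClopen A) (hne : A.Nonempty) :
    ¬ Bornology.IsBounded A := by
  rw [(isClopen_iff.mp hA).resolve_left hne.ne_empty]
  exact NormedSpace.unbounded_univ ℝ ℂ

lemma closure_connectedComponentIn_subset {X : Type*} [TopologicalSpace X] (F : Set X) (x : X) :
    closure (connectedComponentIn F x) ∩ F ⊆ connectedComponentIn F x := by
  rintro z ⟨hz, hzF⟩
  by_cases hx : x ∈ F
  · exact (isPreconnected_connectedComponentIn.subset_closure (subset_insert z _)
      (insert_subset hz subset_closure)).subset_connectedComponentIn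
      (mem_insert_of_mem z (mem_connectedComponentIn hx))
      (insert_subset hzF (connectedComponentIn_subset F x)) (mem_insert z _)
  · simp [connectedComponentIn_eq_empty hx] at hz

/-- A compact subset `L` of an open set `U` does not enclose a point outside `U` if `U \ L` is
connected. -/
lemma not_isBounded_connectedComponentIn {U L : Set ℂ} (hU : IsOpen U) (hL : IsCompact L)
    (hLU : L ⊆ U) (hc : IsPreconnected (U \ L)) {p : ℂ} (hp : p ∉ U) :
    ¬ Bornology.IsBounded (connectedComponentIn Lᶜ p) := by
  intro hbd
  set A := connectedComponentIn Lᶜ p with hA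
  have hpA : p ∈ A := mem_connectedComponentIn fun h ↦ hp (hLU h)
  have hAo : IsOpen A := hL.isClosed.isOpen_compl.connectedComponentIn
  have hAL : A ⊆ Lᶜ := connectedComponentIn_subset _ _
  have hcl : closure A ⊆ A ∪ L := fun z hz ↦ by
    by_cases hzL : z ∈ L
    · exact Or.inr hzL
    · exact Or.inl (closure_connectedComponentIn_subset _ _ ⟨hz, hzL⟩)
  -- If $A$ meets $U\setminus L$, it contains it, and $A\cup L = A\cup U$ is clopen and bounded.
  -- Otherwise $A$ misses $U$ and is itself clopen and bounded. Neither is possible in the plane.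
  by_cases hmeet : ∃ z ∈ U \ L, z ∈ A
  · obtain ⟨z, hz, hzA⟩ := hmeet
    have hsub : U \ L ⊆ A := by
      rw [hA, connectedComponentIn_eq hzA]
      exact hc.subset_connectedComponentIn hz fun w hw ↦ hw.2
    have hM : A ∪ L = A ∪ U := by
      refine subset_antisymm (union_subset_union_right A hLU) (union_subset subset_union_left ?_)
      intro w hw
      by_cases hwL : w ∈ L
      · exact Or.inr hwL
      · exact Or.inl (hsub ⟨hw, hwL⟩)
    refine IsClopen.not_isBounded (A := A ∪ L) ⟨?_, ?_⟩ ⟨p, Or.inl hpA⟩ (hbd.union hL.isBounded)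
    · refine isClosed_of_closure_subset ?_
      rw [closure_union, hL.isClosed.closure_eq]
      exact union_subset hcl subset_union_right
    · rw [hM]
      exact hAo.union hU
  · push Not at hmeet
    have hdisj : Disjoint A U := by
      rw [Set.disjoint_left]
      exact fun z hzA hzU ↦ hmeet z ⟨hzU, hAL hzA⟩ hzA
    refine IsClopen.not_isBounded (A := A) ⟨?_, hAo⟩ ⟨p, hpA⟩ hbd
    refine isClosed_of_closure_subset fun z hz ↦ (hcl hz).resolve_right fun hzL ↦ ?_
    exact Set.disjoint_left.mp (hdisj.closure_left hU) hz (hLU hzL)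

/-- Injective nonvanishing open maps on the complement of an arc have logarithms. -/
lemma hasContLog_of_injOn_invCompl {a b : ℂ} (γ : Path a b) (hγ : Function.Injective γ)
    (h0 : (0 : ℂ) ∈ range γ) {g : ℂ → ℂ} (hg : ContinuousOn g (invCompl (range γ)))
    (hinj : InjOn g (invCompl (range γ))) (hne : ∀ z ∈ invCompl (range γ), g z ≠ 0)
    (hopen : IsOpen (g '' invCompl (range γ))) : HasContLog g (invCompl (range γ)) := by
  set K := range γ with hKdef
  have hK : IsCompact K := isCompact_range γ.continuous
  have hKp : IsPreconnected K := isPreconnected_range γ.continuous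
  set Ω := invCompl K with hΩ
  have hΩo : IsOpen Ω := isOpen_invCompl hK
  refine hasContLog_of_forall_isCompact hΩo
    (isPreconnected_invCompl hK h0 (isPreconnected_compl_arc γ hγ)) hg hne fun C hC hCc ↦ ?_
  obtain ⟨ε, hε, hεC⟩ : ∃ ε > 0, C ⊆ invCompl (cthickening ε K) := by
    have hmono : ∀ ⦃s t : {ε : ℝ // 0 < ε}⦄, s ≤ t →
        invCompl (cthickening t K) ⊆ invCompl (cthickening s K) := fun s t hst _ hw ↦
      hw.imp_right fun h h' ↦ h (cthickening_mono hst K h')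
    have : Nonempty {ε : ℝ // 0 < ε} := ⟨⟨1, one_pos⟩⟩
    have hcov : C ⊆ ⋃ ε : {ε : ℝ // 0 < ε}, invCompl (cthickening ε K) := by
      intro w hw
      rw [mem_iUnion]
      rcases hC hw with h | h
      · exact ⟨⟨1, one_pos⟩, Or.inl h⟩
      · rw [← hK.isClosed.closure_eq, closure_eq_iInter_cthickening] at h
        simp only [mem_iInter, not_forall] at h
        obtain ⟨δ, hδ, h⟩ := h
        exact ⟨⟨δ, hδ⟩, Or.inr h⟩
    obtain ⟨ε, h⟩ := hCc.elim_directed_cover _ (fun ε ↦ isOpen_invCompl hK.cthickening) hcov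
      (directed_of_isDirected_ge hmono)
    exact ⟨ε, ε.2, h⟩
  -- $\Omega\setminus L$ is the inverted collar of $K$, connected since the arc does not separate
  -- its thickening. The open thickening makes $L$ closed, and $0\in K$ makes it bounded.
  set L := {w : ℂ | w = 0 ∨ w⁻¹ ∉ thickening ε K} with hL
  have hCL : C ⊆ L := fun w hw ↦
    (hεC hw).imp_right fun h h' ↦ h (thickening_subset_cthickening ε K h')
  have hLΩ : L ⊆ Ω := fun w hw ↦ hw.imp_right fun h h' ↦ h (self_subset_thickening hε K h')
  have hLc : IsCompact L := by
    refine isCompact_of_isClosed_isBounded ?_ ?_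
    · have : Lᶜ = {0}ᶜ ∩ Inv.inv ⁻¹' thickening ε K := by
        ext w
        simp [hL]
      rw [← isOpen_compl_iff, this]
      exact continuousOn_inv₀.isOpen_inter_preimage isOpen_compl_singleton isOpen_thickening
    · refine (isBounded_closedBall (x := (0 : ℂ)) (r := ε⁻¹)).subset fun w hw ↦ ?_
      rw [mem_closedBall_zero_iff]
      rcases hw with rfl | hw
      · simpa using hε.le
      · by_contra! hlt
        refine hw (ball_subset_thickening h0 ε ?_)
        rw [mem_ball_zero_iff, norm_inv]
        exact inv_lt_of_inv_lt₀ hε hlt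
  have hdiff : Ω \ L = Inv.inv '' (thickening ε K \ K) := by
    ext w
    have hwL : w ∈ L ↔ w = 0 ∨ w⁻¹ ∉ thickening ε K := Iff.rfl
    have hwΩ : w ∈ Ω ↔ w = 0 ∨ w⁻¹ ∉ K := Iff.rfl
    have hw0 : w = 0 → w⁻¹ ∈ K := by
      rintro rfl
      simpa using h0
    rw [Set.mem_sdiff, hwL, hwΩ, image_inv_eq_inv, Set.mem_inv, Set.mem_sdiff]
    tauto
  have hconn : IsPreconnected (Ω \ L) := by
    rw [hdiff]
    exact isPreconnected_inv_image (isPreconnected_diff_arc γ hγ isOpen_thickening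
      (isPreconnected_thickening hKp hε) hK.isBounded.thickening (self_subset_thickening hε K))
      fun h ↦ h.2 h0
  have hlog : HasContLog (fun z ↦ z) (g '' L) := by
    refine hasContLog_id_of_not_isBounded (hLc.image_of_continuousOn (hg.mono hLΩ))
      (not_isBounded_connectedComponentIn hopen (hLc.image_of_continuousOn (hg.mono hLΩ))
        (image_mono hLΩ) ?_ ?_)
    · rw [← hinj.image_sdiff_subset hLΩ]
      exact hconn.image g (hg.mono sdiff_subset)
    · rintro ⟨z, hz, hz0⟩
      exact hne z hz hz0
  exact (hlog.comp (hg.mono hLΩ) (mapsTo_image g L)).mono hCL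

/-! ### Limits of holomorphic functions -/

/-- **Hurwitz's theorem**: a locally uniform limit of injective holomorphic functions is injective
or constant. -/
lemma injOn_of_tendstoLocallyUniformlyOn {ι : Type*} {U : Set ℂ} (hU : IsOpen U)
    (hc : IsPreconnected U) {p : Filter ι} [p.NeBot] {F : ι → ℂ → ℂ} {f : ℂ → ℂ}
    (hF : ∀ i, DifferentiableOn ℂ (F i) U) (hinj : ∀ i, InjOn (F i) U)
    (hlim : TendstoLocallyUniformlyOn F f p U) (hne : ∀ c, ∃ z ∈ U, f z ≠ c) : InjOn f U := by
  intro x hx y hy hxy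
  by_contra hxy'
  have hfd : DifferentiableOn ℂ f U := hlim.differentiableOn (Eventually.of_forall hF) hU
  have hiso : ∀ᶠ z in 𝓝[≠] x, f z - f y ≠ 0 := by
    have han : AnalyticOnNhd ℂ (fun z ↦ f z - f y) U := (hfd.sub_const _).analyticOnNhd hU
    refine (han x hx).eventually_eq_zero_or_eventually_ne_zero.resolve_left fun h ↦ ?_
    obtain ⟨z, hz, hzne⟩ := hne (f y)
    exact hzne (sub_eq_zero.mp (han.eqOn_zero_of_preconnected_of_eventuallyEq_zero hc hx h hz))
  have hall : ∀ᶠ z in 𝓝 x, z ∈ U ∧ z ≠ y ∧ (z ≠ x → f z - f y ≠ 0) :=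
    (hU.eventually_mem hx).and ((isOpen_ne.eventually_mem hxy').and
      (eventually_nhdsWithin_iff.mp hiso))
  obtain ⟨r, hr, hball⟩ := Metric.nhds_basis_closedBall.eventually_iff.mp hall
  have hsub : closedBall x r ⊆ U := fun z hz ↦ (hball hz).1
  obtain ⟨δ, hδ, hδs⟩ : ∃ δ > 0, ∀ z ∈ sphere x r, δ ≤ ‖f z - f y‖ := by
    have hcont : ContinuousOn (fun z ↦ ‖f z - f y‖) (sphere x r) :=
      ((hfd.continuousOn.mono (sphere_subset_closedBall.trans hsub)).sub continuousOn_const).norm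
    obtain ⟨w, hw, hmin⟩ := (isCompact_sphere x r).exists_isMinOn
      (NormedSpace.sphere_nonempty.mpr hr.le) hcont
    refine ⟨‖f w - f y‖, norm_pos_iff.mpr ((hball (sphere_subset_closedBall hw)).2.2 ?_), hmin⟩
    exact ne_of_mem_sphere hw hr.ne'
  have hunif := (tendstoLocallyUniformlyOn_iff_forall_isCompact hU).mp hlim
    (insert y (closedBall x r)) (insert_subset hy hsub) ((isCompact_closedBall x r).insert y)
  obtain ⟨i, hi⟩ := (Metric.tendstoUniformlyOn_iff.mp hunif (δ / 4) (by positivity)).exists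
  have happ : ∀ z ∈ closedBall x r, ‖(f z - f y) - (F i z - F i y)‖ < δ / 2 := by
    intro z hz
    have h1 := hi z (mem_insert_of_mem y hz)
    have h2 := hi y (mem_insert _ _)
    rw [dist_eq_norm] at h1 h2
    calc ‖(f z - f y) - (F i z - F i y)‖ = ‖(f z - F i z) - (f y - F i y)‖ := by ring_nf
      _ ≤ _ := norm_sub_le _ _
      _ < δ / 2 := by linarith
  have hnz : ∀ z ∈ closedBall x r, F i z - F i y ≠ 0 := fun z hz h ↦
    (hball hz).2.1 (hinj i (hsub hz) hy (sub_eq_zero.mp h))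
  -- The maximum principle for the reciprocal replaces zero counting: it keeps $F_i(x)-F_i(y)$ at
  -- least $\delta/2$ in norm, while $f(x)=f(y)$ makes it smaller.
  have hmax : ‖(F i x - F i y)⁻¹‖ ≤ (δ / 2)⁻¹ := by
    refine norm_le_of_forall_mem_frontier_norm_le (f := fun z ↦ (F i z - F i y)⁻¹)
      (isBounded_ball (x := x) (r := r)) ?_ ?_ (subset_closure (mem_ball_self hr))
    · refine DifferentiableOn.diffContOnCl ?_
      rw [closure_ball x hr.ne']
      exact ((hF i).mono hsub |>.sub_const _).inv hnz
    · intro z hz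
      rw [frontier_ball x hr.ne'] at hz
      have h1 := hδs z hz
      have h2 := happ z (sphere_subset_closedBall hz)
      have h3 := norm_sub_norm_le (f z - f y) (F i z - F i y)
      rw [norm_inv]
      exact inv_anti₀ (by positivity) (by linarith)
  have hx0 := happ x (mem_closedBall_self hr.le)
  rw [hxy, sub_self, zero_sub, norm_neg] at hx0
  rw [norm_inv, inv_le_inv₀ (norm_pos_iff.mpr (hnz x (mem_closedBall_self hr.le)))
    (by positivity)] at hmax
  linarith

/-- **Montel's theorem** for sequences of holomorphic functions bounded by `1`. -/
lemma exists_tendstoLocallyUniformlyOn {U : Set ℂ} (hU : IsOpen U) {F : ℕ → ℂ → ℂ}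
    (hF : ∀ i, DifferentiableOn ℂ (F i) U) (hb : ∀ i, ∀ z ∈ U, ‖F i z‖ ≤ 1) :
    ∃ f : ℂ → ℂ, TendstoLocallyUniformlyOn F f (hyperfilter ℕ : Filter ℕ) U := by
  classical
  -- The Lipschitz bound comes from the Schwarz lemma, with $2$ bounding differences of values. It
  -- survives pointwise limits and forces continuity, so Arzelà–Ascoli applies via the pointwise
  -- compact set $T$.
  let S : Set C(U, ℂ) := {G | (∀ x, ‖G x‖ ≤ 1) ∧ ∀ (x y : U) (r : ℝ), 0 < r →
    ball (x : ℂ) r ⊆ U → (y : ℂ) ∈ ball (x : ℂ) r → dist (G y) (G x) ≤ 2 / r * dist (y : ℂ) x}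
  let T : Set (U → ℂ) := {G | (∀ x, G x ∈ closedBall (0 : ℂ) 1) ∧ ∀ (x y : U) (r : ℝ), 0 < r →
    ball (x : ℂ) r ⊆ U → (y : ℂ) ∈ ball (x : ℂ) r → dist (G y) (G x) ≤ 2 / r * dist (y : ℂ) x}
  have hlip : ∀ (x : U) (r : ℝ), Tendsto (fun z : U ↦ 2 / r * dist (z : ℂ) x) (𝓝 x) (𝓝 0) := by
    intro x r
    have : Continuous fun z : U ↦ 2 / r * dist (z : ℂ) x := by fun_prop
    simpa using this.tendsto x
  have hr : ∀ x : U, ∃ r > 0, ball (x : ℂ) r ⊆ U := fun x ↦ Metric.isOpen_iff.mp hU x x.2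
  have hev : ∀ (x : U) {r : ℝ}, 0 < r → ∀ᶠ y : U in 𝓝 x, (y : ℂ) ∈ ball (x : ℂ) r := fun x r hr ↦
    continuous_subtype_val.continuousAt.eventually (ball_mem_nhds (x : ℂ) hr)
  have hT : T = ContinuousMap.toFun '' S := by
    ext G
    constructor
    · rintro ⟨h1, h2⟩
      refine ⟨⟨G, ?_⟩, ⟨fun x ↦ mem_closedBall_zero_iff.mp (h1 x), h2⟩, rfl⟩
      rw [continuous_iff_continuousAt]
      intro x
      obtain ⟨r, hr0, hrU⟩ := hr x
      rw [ContinuousAt, tendsto_iff_dist_tendsto_zero]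
      refine squeeze_zero' (Eventually.of_forall fun _ ↦ dist_nonneg) ?_
        (hlip x r)
      filter_upwards [hev x hr0] with y hy using h2 x y r hr0 hrU hy
    · rintro ⟨G, ⟨h1, h2⟩, rfl⟩
      exact ⟨fun x ↦ by simpa using h1 x, h2⟩
  have hTc : IsCompact T := by
    refine (isCompact_univ_pi fun _ : U ↦ isCompact_closedBall (0 : ℂ) 1).of_isClosed_subset ?_
      fun G hG x _ ↦ hG.1 x
    simp only [T, ofPred_and, ofPred_forall]
    refine IsClosed.inter (isClosed_iInter fun x ↦ isClosed_closedBall.preimage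
      (continuous_apply x)) ?_
    refine isClosed_iInter fun x ↦ isClosed_iInter fun y ↦ isClosed_iInter fun r ↦
      isClosed_iInter fun _ ↦ isClosed_iInter fun _ ↦ isClosed_iInter fun _ ↦ ?_
    exact isClosed_le (by fun_prop) continuous_const
  have hS : IsCompact S := by
    refine ArzelaAscoli.isCompact_of_equicontinuous S (hT ▸ hTc) fun x ↦ ?_
    obtain ⟨r, hr0, hrU⟩ := hr x
    refine Metric.equicontinuousAt_of_continuity_modulus _ (hlip x r)
      _ ?_
    filter_upwards [hev x hr0] with y hy G
    rw [dist_comm]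
    exact G.2.2 x y r hr0 hrU hy
  let Φ : ℕ → C(U, ℂ) := fun i ↦
    ⟨U.domRestrict (F i), continuousOn_iff_continuous_domRestrict.mp (hF i).continuousOn⟩
  have hΦ : ∀ i, Φ i ∈ S := by
    refine fun i ↦ ⟨fun x ↦ hb i x x.2, fun x y r hr0 hrU hy ↦ ?_⟩
    refine dist_le_div_mul_dist_of_mapsTo_ball ((hF i).mono hrU) (fun z hz ↦ ?_) hy
    rw [mem_closedBall, dist_eq_norm]
    refine (norm_sub_le _ _).trans ?_
    linarith [hb i z (hrU hz), hb i x x.2]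
  -- Convergence along an ultrafilter avoids extracting a subsequence.
  obtain ⟨G, -, hG⟩ := hS.ultrafilter_le_nhds ((hyperfilter ℕ).map Φ)
    (by
      rw [Ultrafilter.coe_map, le_principal_iff]
      exact mem_map.mpr (Eventually.of_forall hΦ))
  have := hU.locallyCompactSpace
  have hG' : Tendsto Φ (hyperfilter ℕ) (𝓝 G) := hG
  rw [ContinuousMap.tendsto_iff_tendstoLocallyUniformly] at hG'
  refine ⟨fun z ↦ if hz : z ∈ U then G ⟨z, hz⟩ else 0, ?_⟩
  rw [tendstoLocallyUniformlyOn_iff_tendstoLocallyUniformly_comp_coe]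
  convert hG' using 1
  · rfl
  · funext z
    simp

/-! ### The Riemann mapping theorem -/

/-- The disc automorphism taking `a` to `0`. -/
noncomputable def mobius (a z : ℂ) : ℂ := (z - a) / (1 - starRingEnd ℂ a * z)

lemma one_sub_conj_mul_ne_zero {a z : ℂ} (ha : ‖a‖ < 1) (hz : ‖z‖ < 1) :
    1 - starRingEnd ℂ a * z ≠ 0 := by
  rw [sub_ne_zero]
  intro h
  have h1 := congrArg norm h
  rw [norm_mul, norm_one, RCLike.norm_conj] at h1
  nlinarith [norm_nonneg a, norm_nonneg z]

/-- This is the identity $|1-\bar a z|^2-|z-a|^2=(1-|a|^2)(1-|z|^2)$. -/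
lemma norm_mobius_lt_one {a z : ℂ} (ha : ‖a‖ < 1) (hz : ‖z‖ < 1) : ‖mobius a z‖ < 1 := by
  have h0 := one_sub_conj_mul_ne_zero ha hz
  rw [mobius, norm_div, div_lt_one (norm_pos_iff.mpr h0), ← sq_lt_sq₀ (norm_nonneg _) (norm_nonneg _)]
  rw [← sq_lt_one_iff₀ (norm_nonneg _)] at ha hz
  rw [← normSq_eq_norm_sq, normSq_apply] at ha hz ⊢
  rw [← normSq_eq_norm_sq, normSq_apply]
  simp only [sub_re, sub_im, mul_re, mul_im, conj_re, conj_im, one_re, one_im]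
  nlinarith [mul_pos (sub_pos.mpr ha) (sub_pos.mpr hz)]

lemma mobius_injOn {a : ℂ} (ha : ‖a‖ < 1) : InjOn (mobius a) (ball 0 1) := by
  intro z hz w hw h
  rw [mem_ball_zero_iff] at hz hw
  rw [mobius, mobius, div_eq_div_iff (one_sub_conj_mul_ne_zero ha hz)
    (one_sub_conj_mul_ne_zero ha hw)] at h
  have h1 : (1 - starRingEnd ℂ a * a) * (z - w) = 0 := by linear_combination h
  exact sub_eq_zero.mp ((mul_eq_zero.mp h1).resolve_left (one_sub_conj_mul_ne_zero ha ha))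

lemma hasDerivAt_mobius {a z : ℂ} (ha : ‖a‖ < 1) (hz : ‖z‖ < 1) :
    HasDerivAt (mobius a) ((1 - starRingEnd ℂ a * a) / (1 - starRingEnd ℂ a * z) ^ 2) z := by
  have h1 : HasDerivAt (fun z ↦ z - a) 1 z := (hasDerivAt_id z).sub_const a
  have h2 : HasDerivAt (fun z ↦ 1 - starRingEnd ℂ a * z) (-(starRingEnd ℂ a * 1)) z :=
    ((hasDerivAt_id z).const_mul _).const_sub 1
  exact (h1.fun_div h2 (one_sub_conj_mul_ne_zero ha hz)).congr_deriv (by ring)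

/-- A continuous square root of a holomorphic function is holomorphic. -/
lemma hasDerivAt_of_sq_eq {U : Set ℂ} (hU : IsOpen U) {f s : ℂ → ℂ} (hs : ContinuousOn s U)
    (hsq : ∀ z ∈ U, s z ^ 2 = f z) {z f' : ℂ} (hz : z ∈ U) (h0 : s z ≠ 0)
    (hf : HasDerivAt f f' z) : HasDerivAt s (f' / (2 * s z)) z := by
  rw [hasDerivAt_iff_tendsto_slope] at hf ⊢
  have hc : Tendsto (fun w ↦ s w + s z) (𝓝[≠] z) (𝓝 (2 * s z)) := by
    rw [two_mul]
    exact ((hs.continuousAt (hU.mem_nhds hz)).tendsto.mono_left nhdsWithin_le_nhds).add_const _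
  have h2 : 2 * s z ≠ 0 := mul_ne_zero two_ne_zero h0
  refine (hf.div hc h2).congr' ?_
  filter_upwards [hc.eventually_ne h2, mem_nhdsWithin_of_mem_nhds (hU.mem_nhds hz)] with w hw hwU
  rw [Pi.div_apply, slope_def_field, slope_def_field, ← hsq z hz, ← hsq w hwU, div_div,
    mul_comm (w - z), ← div_div]
  congr 1
  rw [div_eq_iff hw]
  ring

/-- Injective holomorphic maps `U → 𝔻` fixing the origin. -/
structure IsDiscEmbedding (U : Set ℂ) (f : ℂ → ℂ) : Prop where
  differentiableOn : DifferentiableOn ℂ f U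
  injOn : InjOn f U
  mapsTo : MapsTo f U (ball 0 1)
  map_zero : f 0 = 0

/-- Every injective nonvanishing holomorphic function has a continuous square root. -/
def HasSqrts (U : Set ℂ) : Prop :=
  ∀ g : ℂ → ℂ, DifferentiableOn ℂ g U → InjOn g U → (∀ z ∈ U, g z ≠ 0) →
    ∃ s : ℂ → ℂ, ContinuousOn s U ∧ ∀ z ∈ U, s z ^ 2 = g z

section RiemannMapping

variable {U : Set ℂ} (hU : IsOpen U) (h0 : (0 : ℂ) ∈ U) (hs : HasSqrts U)
include hU h0

lemma isOpen_image_of_injOn (hc : IsPreconnected U) {f : ℂ → ℂ} (hf : DifferentiableOn ℂ f U)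
    (hinj : InjOn f U) : ∀ s ⊆ U, IsOpen s → IsOpen (f '' s) := by
  refine ((hf.analyticOnNhd hU).is_constant_or_isOpen hc).resolve_left ?_
  rintro ⟨c, hconst⟩
  obtain ⟨z, hz, hz0⟩ : ∃ z ∈ U, z ≠ 0 := by
    have h1 : ∀ᶠ z in 𝓝[≠] (0 : ℂ), z ∈ U := mem_nhdsWithin_of_mem_nhds (hU.mem_nhds h0)
    obtain ⟨z, hz⟩ := (h1.and self_mem_nhdsWithin).exists
    exact ⟨z, hz.1, hz.2⟩
  exact hz0 (hinj hz h0 ((hconst z hz).trans (hconst 0 h0).symm))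

include hs

/-- A square root $s$ of $z-a$ never takes both a value and its negative, so it omits a disc around
$-s(0)$, and $1/(s+s(0))$ is bounded and injective. -/
lemma exists_isDiscEmbedding (hc : IsPreconnected U) {a : ℂ} (ha : a ∉ U) :
    ∃ f, IsDiscEmbedding U f ∧ deriv f 0 ≠ 0 := by
  obtain ⟨s, hsc, hsq⟩ := hs (fun z ↦ z - a) (by fun_prop) (fun z _ w _ h ↦ sub_left_injective h)
    (fun z hz h ↦ ha (sub_eq_zero.mp h ▸ hz))
  have hs0 : ∀ z ∈ U, s z ≠ 0 := fun z hz h ↦ by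
    have h1 := hsq z hz
    rw [h, zero_pow two_ne_zero, eq_comm, sub_eq_zero] at h1
    exact ha (h1 ▸ hz)
  have hinj' : ∀ z ∈ U, ∀ w ∈ U, s z ^ 2 = s w ^ 2 → z = w := fun z hz w hw h ↦ by
    rw [hsq z hz, hsq w hw] at h
    exact sub_left_injective h
  have hinj : InjOn s U := fun z hz w hw h ↦ hinj' z hz w hw (by rw [h])
  have hd : ∀ z ∈ U, HasDerivAt s (1 / (2 * s z)) z := fun z hz ↦
    hasDerivAt_of_sq_eq hU hsc hsq hz (hs0 z hz) ((hasDerivAt_id z).sub_const a)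
  have hsd : DifferentiableOn ℂ s U := fun z hz ↦
    (hd z hz).differentiableAt.differentiableWithinAt
  obtain ⟨r, hr, hball⟩ := Metric.isOpen_iff.mp
    (isOpen_image_of_injOn hU h0 hc hsd hinj U subset_rfl hU) (s 0) (mem_image_of_mem s h0)
  have hfar : ∀ z ∈ U, r ≤ ‖s z + s 0‖ := by
    intro z hz
    by_contra! hlt
    obtain ⟨w, hw, hws⟩ := hball (show -s z ∈ ball (s 0) r by
      rwa [mem_ball, dist_eq_norm, ← norm_neg, neg_sub, sub_neg_eq_add, add_comm])
    have hwz := hinj' w hw z hz (by rw [hws, neg_sq])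
    rw [hwz] at hws
    exact hs0 z hz (self_eq_neg.mp hws)
  have hne : ∀ z ∈ U, s z + s 0 ≠ 0 := fun z hz ↦
    norm_pos_iff.mp (hr.trans_le (hfar z hz))
  have hr' : (r : ℂ) / 4 ≠ 0 := div_ne_zero (by exact_mod_cast hr.ne') (by norm_num)
  have hfd : ∀ z ∈ U, HasDerivAt (fun z ↦ (r : ℂ) / 4 * ((s z + s 0)⁻¹ - (s 0 + s 0)⁻¹))
      ((r : ℂ) / 4 * (-(1 / (2 * s z)) / (s z + s 0) ^ 2)) z := fun z hz ↦
    ((((hd z hz).add_const (s 0)).fun_inv (hne z hz)).sub_const _).const_mul _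
  refine ⟨fun z ↦ (r : ℂ) / 4 * ((s z + s 0)⁻¹ - (s 0 + s 0)⁻¹), ⟨?_, ?_, ?_, ?_⟩, ?_⟩
  · exact fun z hz ↦ (hfd z hz).differentiableAt.differentiableWithinAt
  · intro z hz w hw h
    have h1 := mul_left_cancel₀ hr' h
    exact hinj hz hw (add_right_cancel (inv_injective (sub_left_injective h1)))
  · intro z hz
    have hinv : ∀ w ∈ U, ‖(s w + s 0)⁻¹‖ ≤ r⁻¹ := fun w hw ↦ by
      rw [norm_inv]
      exact inv_anti₀ hr (hfar w hw)
    rw [mem_ball_zero_iff, norm_mul]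
    have h1 : ‖(r : ℂ) / 4‖ = r / 4 := by
      rw [norm_div, norm_real, Real.norm_of_nonneg hr.le]
      norm_num
    calc ‖(r : ℂ) / 4‖ * ‖(s z + s 0)⁻¹ - (s 0 + s 0)⁻¹‖ ≤ r / 4 * (r⁻¹ + r⁻¹) := by
          rw [h1]
          gcongr
          exact (norm_sub_le _ _).trans (add_le_add (hinv z hz) (hinv 0 h0))
      _ = 1 / 2 := by field_simp; norm_num
      _ < 1 := by norm_num
  · simp
  · rw [(hfd 0 h0).deriv]
    have h1 := hs0 0 h0
    have h2 := hne 0 h0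
    exact mul_ne_zero hr' (div_ne_zero (by simpa using h1) (pow_ne_zero 2 h2))

-- Cauchy's estimate bounds the derivatives at $0$, and a Montel limit attains their supremum. Its
-- derivative is nonzero, so it is injective by Hurwitz, and the open mapping theorem keeps its
-- image in the open disc.
omit hs in
lemma exists_isDiscEmbedding_norm_deriv_max (hc : IsPreconnected U) {f₀ : ℂ → ℂ}
    (hf₀ : IsDiscEmbedding U f₀) (hd₀ : deriv f₀ 0 ≠ 0) :
    ∃ f, IsDiscEmbedding U f ∧ deriv f 0 ≠ 0 ∧
      ∀ g, IsDiscEmbedding U g → ‖deriv g 0‖ ≤ ‖deriv f 0‖ := by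
  set M : Set ℝ := (fun f ↦ ‖deriv f 0‖) '' {f | IsDiscEmbedding U f} with hM
  have hbdd : BddAbove M := by
    obtain ⟨r, hr, hrU⟩ := Metric.nhds_basis_closedBall.mem_iff.mp (hU.mem_nhds h0)
    refine ⟨1 / r, ?_⟩
    rintro _ ⟨f, hf, rfl⟩
    refine norm_deriv_le_of_forall_mem_sphere_norm_le hr ?_ fun z hz ↦ ?_
    · refine DifferentiableOn.diffContOnCl ?_
      rw [closure_ball _ hr.ne']
      exact hf.differentiableOn.mono hrU
    · have := hf.mapsTo (hrU (sphere_subset_closedBall hz))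
      rw [mem_ball_zero_iff] at this
      exact this.le
  obtain ⟨u, -, hu, huM⟩ := exists_seq_tendsto_sSup (S := M) ⟨_, f₀, hf₀, rfl⟩ hbdd
  choose F hF hFu using huM
  obtain ⟨f, hf⟩ := exists_tendstoLocallyUniformlyOn hU (fun i ↦ (hF i).differentiableOn)
    fun i z hz ↦ (mem_ball_zero_iff.mp ((hF i).mapsTo hz)).le
  have hdiff : DifferentiableOn ℂ f U :=
    hf.differentiableOn (Eventually.of_forall fun i ↦ (hF i).differentiableOn) hU
  have hder : ‖deriv f 0‖ = sSup M := by
    have h1 := ((hf.deriv (Eventually.of_forall fun i ↦ (hF i).differentiableOn) hU).tendsto_at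
      h0).norm
    have h2 : Tendsto (fun i ↦ ‖deriv (F i) 0‖) (hyperfilter ℕ) (𝓝 (sSup M)) := by
      simp only [hFu]
      exact hu.mono_left Nat.hyperfilter_le_atTop
    exact tendsto_nhds_unique h1 h2
  have hmax : ∀ g, IsDiscEmbedding U g → ‖deriv g 0‖ ≤ ‖deriv f 0‖ := fun g hg ↦
    hder ▸ le_csSup hbdd ⟨g, hg, rfl⟩
  have hd : deriv f 0 ≠ 0 := norm_pos_iff.mp ((norm_pos_iff.mpr hd₀).trans_le (hmax f₀ hf₀))
  have hinj : InjOn f U := by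
    refine injOn_of_tendstoLocallyUniformlyOn hU hc (fun i ↦ (hF i).differentiableOn)
      (fun i ↦ (hF i).injOn) hf fun c ↦ ?_
    by_contra! hcon
    refine hd (((hasDerivAt_const (0 : ℂ) c).congr_of_eventuallyEq ?_).deriv)
    filter_upwards [hU.mem_nhds h0] with z hz using hcon z hz
  refine ⟨f, ⟨hdiff, hinj, ?_, ?_⟩, hd, hmax⟩
  · have hle : f '' U ⊆ closedBall 0 1 := by
      rintro _ ⟨z, hz, rfl⟩
      rw [mem_closedBall_zero_iff]
      exact le_of_tendsto (hf.tendsto_at hz).norm (Eventually.of_forall fun i ↦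
        (mem_ball_zero_iff.mp ((hF i).mapsTo hz)).le)
    rw [mapsTo_iff_image_subset, ← interior_closedBall (0 : ℂ) one_ne_zero]
    exact interior_maximal hle (isOpen_image_of_injOn hU h0 hc hdiff hinj U subset_rfl hU)
  · refine tendsto_nhds_unique (hf.tendsto_at h0) ?_
    simp only [(hF _).map_zero]
    exact tendsto_const_nhds

/-- Koebe's trick: move the omitted value to $0$, take a square root, and recentre. With $b^2=-a$
the derivative is multiplied in modulus by $(1+|b|^2)/(2|b|)>1$. -/
lemma exists_norm_deriv_lt {f : ℂ → ℂ} (hf : IsDiscEmbedding U f) (hd : deriv f 0 ≠ 0) {a : ℂ}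
    (ha : ‖a‖ < 1) (haU : a ∉ f '' U) :
    ∃ g, IsDiscEmbedding U g ∧ ‖deriv f 0‖ < ‖deriv g 0‖ := by
  have hfn : ∀ z ∈ U, ‖f z‖ < 1 := fun z hz ↦ mem_ball_zero_iff.mp (hf.mapsTo hz)
  have hgd : ∀ z ∈ U, HasDerivAt (fun z ↦ mobius a (f z))
      ((1 - starRingEnd ℂ a * a) / (1 - starRingEnd ℂ a * f z) ^ 2 * deriv f z) z := fun z hz ↦
    (hasDerivAt_mobius ha (hfn z hz)).comp z
      ((hf.differentiableOn z hz).differentiableAt (hU.mem_nhds hz)).hasDerivAt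
  have hginj : InjOn (fun z ↦ mobius a (f z)) U := fun z hz w hw h ↦
    hf.injOn hz hw (mobius_injOn ha (hf.mapsTo hz) (hf.mapsTo hw) h)
  have hg0 : ∀ z ∈ U, mobius a (f z) ≠ 0 := fun z hz ↦
    div_ne_zero (sub_ne_zero.mpr fun h ↦ haU ⟨z, hz, h⟩) (one_sub_conj_mul_ne_zero ha (hfn z hz))
  obtain ⟨s, hsc, hsq⟩ := hs (fun z ↦ mobius a (f z))
    (fun z hz ↦ (hgd z hz).differentiableAt.differentiableWithinAt) hginj hg0
  have hs0 : ∀ z ∈ U, s z ≠ 0 := fun z hz h ↦ hg0 z hz (by rw [← hsq z hz, h, zero_pow two_ne_zero])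
  have hsn : ∀ z ∈ U, ‖s z‖ < 1 := fun z hz ↦ by
    rw [← sq_lt_one_iff₀ (norm_nonneg _), ← norm_pow, hsq z hz]
    exact norm_mobius_lt_one ha (hfn z hz)
  have hsd : ∀ z ∈ U, HasDerivAt s _ z := fun z hz ↦
    hasDerivAt_of_sq_eq hU hsc hsq hz (hs0 z hz) (hgd z hz)
  set b := s 0 with hb
  have hbn : ‖b‖ < 1 := hsn 0 h0
  have hhd : ∀ z ∈ U, HasDerivAt (fun z ↦ mobius b (s z)) _ z := fun z hz ↦
    (hasDerivAt_mobius hbn (hsn z hz)).comp z (hsd z hz)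
  refine ⟨fun z ↦ mobius b (s z), ⟨?_, ?_, ?_, ?_⟩, ?_⟩
  · exact fun z hz ↦ (hhd z hz).differentiableAt.differentiableWithinAt
  · intro z hz w hw h
    have h1 : s z = s w := mobius_injOn hbn (mem_ball_zero_iff.mpr (hsn z hz))
      (mem_ball_zero_iff.mpr (hsn w hw)) h
    refine hginj hz hw ?_
    simp only [← hsq z hz, ← hsq w hw, h1]
  · exact fun z hz ↦ mem_ball_zero_iff.mpr (norm_mobius_lt_one hbn (hsn z hz))
  · simp [mobius, hb]
  · rw [(hhd 0 h0).deriv, hf.map_zero, ← hb]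
    have hab : b ^ 2 = -a := by
      rw [hsq 0 h0, hf.map_zero]
      simp [mobius]
    have hbpos : 0 < ‖b‖ := norm_pos_iff.mpr (hs0 0 h0)
    have hnb : starRingEnd ℂ b * b = ((‖b‖ ^ 2 : ℝ) : ℂ) := by
      rw [mul_comm, mul_conj, normSq_eq_norm_sq]
    have hna : starRingEnd ℂ a * a = ((‖b‖ ^ 4 : ℝ) : ℂ) := by
      have : ‖a‖ = ‖b‖ ^ 2 := by rw [← norm_neg, ← hab, norm_pow]
      rw [mul_comm, mul_conj, normSq_eq_norm_sq, this]
      ring_nf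
    rw [hna, hnb]
    have hpos : 0 < 1 - ‖b‖ ^ 2 := sub_pos.mpr ((sq_lt_one_iff₀ (norm_nonneg _)).mpr hbn)
    have hpos' : (1 - ((‖b‖ ^ 2 : ℝ) : ℂ)) ≠ 0 := by
      rw [← ofReal_one, ← ofReal_sub]
      exact_mod_cast hpos.ne'
    have hb0 : b ≠ 0 := hs0 0 h0
    have heq : (1 - ((‖b‖ ^ 2 : ℝ) : ℂ)) / (1 - ((‖b‖ ^ 2 : ℝ) : ℂ)) ^ 2 *
        ((1 - ((‖b‖ ^ 4 : ℝ) : ℂ)) / (1 - starRingEnd ℂ a * 0) ^ 2 * deriv f 0 / (2 * b)) =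
        ((1 + ‖b‖ ^ 2 : ℝ) : ℂ) / (2 * b) * deriv f 0 := by
      push_cast at hpos' ⊢
      field_simp
      ring
    rw [heq, norm_mul, norm_div, norm_real, norm_mul, RCLike.norm_ofNat,
      Real.norm_of_nonneg (by positivity)]
    refine lt_mul_of_one_lt_left (norm_pos_iff.mpr hd) ?_
    rw [one_lt_div (by positivity)]
    nlinarith [sq_pos_of_pos (sub_pos.mpr hbn)]

/-- **Riemann mapping theorem**. -/
theorem exists_riemann_map (hc : IsPreconnected U) {a : ℂ} (ha : a ∉ U) :
    ∃ f, IsDiscEmbedding U f ∧ f '' U = ball 0 1 := by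
  obtain ⟨f₀, hf₀, hd₀⟩ := exists_isDiscEmbedding hU h0 hs hc ha
  obtain ⟨f, hf, hd, hmax⟩ := exists_isDiscEmbedding_norm_deriv_max hU h0 hc hf₀ hd₀
  refine ⟨f, hf, subset_antisymm hf.mapsTo.image_subset fun w hw ↦ ?_⟩
  by_contra hwU
  obtain ⟨g, hg, hlt⟩ := exists_norm_deriv_lt hU h0 hs hf hd (mem_ball_zero_iff.mp hw) hwU
  exact hlt.not_ge (hmax g hg)

end RiemannMapping

/-! ### Collapsing an arc to a point -/

/-- The complement of an arc through `0` in the sphere, in the chart at infinity, is conformally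
equivalent to the unit disc. -/
lemma exists_riemann_map_invCompl {a b : ℂ} (γ : Path a b) (hγ : Function.Injective γ)
    (h0 : (0 : ℂ) ∈ range γ) :
    ∃ f, IsDiscEmbedding (invCompl (range γ)) f ∧ f '' invCompl (range γ) = ball 0 1 := by
  have hK : IsCompact (range γ) := isCompact_range γ.continuous
  have hU := isOpen_invCompl hK
  have hc := isPreconnected_invCompl hK h0 (isPreconnected_compl_arc γ hγ)
  have h0U : (0 : ℂ) ∈ invCompl (range γ) := Or.inl rfl
  obtain ⟨v, hv, hv0⟩ : ∃ v ∈ range γ, v ≠ 0 := by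
    by_contra! h
    exact zero_ne_one (hγ ((h _ (mem_range_self 0)).trans (h _ (mem_range_self 1)).symm))
  refine exists_riemann_map hU h0U (fun g hg hinj hne ↦ ?_) hc (a := v⁻¹) ?_
  · obtain ⟨l, hl, he⟩ := hasContLog_of_injOn_invCompl γ hγ h0 hg.continuousOn hinj hne
      (isOpen_image_of_injOn hU h0U hc hg hinj _ subset_rfl hU)
    refine ⟨fun z ↦ exp (l z / 2), (hl.div_const 2).cexp, fun z hz ↦ ?_⟩
    rw [← exp_nat_mul, ← he z hz]
    congr 1
    push_cast
    ring
  · rintro (h | h)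
    · exact hv0 (inv_eq_zero.mp h)
    · exact h (by rwa [inv_inv])

/-- The modulus $(1-t)/t$ of the value determines $t=|u|$, and then the value determines $u$. -/
lemma one_sub_norm_div_injOn {u v : ℂ} (hu0 : u ≠ 0) (hv0 : v ≠ 0) (hu : ‖u‖ < 1) (hv : ‖v‖ < 1)
    (h : (1 - ‖u‖ : ℂ) / u = (1 - ‖v‖ : ℂ) / v) : u = v := by
  have hnorm : ∀ w : ℂ, ‖w‖ < 1 → ‖(1 - ‖w‖ : ℂ) / w‖ = (1 - ‖w‖) / ‖w‖ := fun w hw ↦ by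
    rw [norm_div, ← ofReal_one, ← ofReal_sub, norm_real, Real.norm_of_nonneg (by linarith)]
  have h1 := congrArg norm h
  rw [hnorm u hu, hnorm v hv, div_eq_div_iff (norm_ne_zero_iff.mpr hu0)
    (norm_ne_zero_iff.mpr hv0)] at h1
  have h2 : ‖u‖ = ‖v‖ := by linarith
  rw [h2] at h
  have h3 : (1 - ‖v‖ : ℂ) ≠ 0 := by
    rw [← ofReal_one, ← ofReal_sub]
    exact_mod_cast (sub_pos.mpr hv).ne'
  rw [div_eq_div_iff hu0 hv0] at h
  exact (mul_left_cancel₀ h3 h).symm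

lemma exists_collapse_of_zero_mem {a b : ℂ} (γ : Path a b) (hγ : Function.Injective γ)
    (h0 : (0 : ℂ) ∈ range γ) :
    ∃ F : ℂ → ℂ, Continuous F ∧ Tendsto F (Bornology.cobounded ℂ) (Bornology.cobounded ℂ) ∧
      ∀ z w, F z = F w ↔ z = w ∨ z ∈ range γ ∧ w ∈ range γ := by
  classical
  obtain ⟨f, hf, hfU⟩ := exists_riemann_map_invCompl γ hγ h0
  set K := range γ with hKdef
  have hK : IsCompact K := isCompact_range γ.continuous
  set U := invCompl K with hUdef
  have hU : IsOpen U := isOpen_invCompl hK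
  have hc : IsPreconnected U := isPreconnected_invCompl hK h0 (isPreconnected_compl_arc γ hγ)
  have h0U : (0 : ℂ) ∈ U := Or.inl rfl
  have hinvU : ∀ z ∉ K, z⁻¹ ∈ U := fun z hz ↦ Or.inr (by rwa [inv_inv])
  have hz0 : ∀ z ∉ K, z ≠ 0 := fun z hz h ↦ hz (h ▸ h0)
  have hfz0 : ∀ z ∉ K, f z⁻¹ ≠ 0 := fun z hz h ↦
    inv_ne_zero (hz0 z hz) (hf.injOn (hinvU z hz) h0U (h.trans hf.map_zero.symm))
  have hfz1 : ∀ z ∉ K, ‖f z⁻¹‖ < 1 := fun z hz ↦ mem_ball_zero_iff.mp (hf.mapsTo (hinvU z hz))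
  let φ : ℂ → ℂ := fun z ↦ (1 - ‖f z⁻¹‖ : ℂ) / f z⁻¹
  let F : ℂ → ℂ := fun z ↦ if z ∈ K then 0 else φ z
  have hFK : ∀ z ∈ K, F z = 0 := fun z hz ↦ if_pos hz
  have hFφ : ∀ z ∉ K, F z = φ z := fun z hz ↦ if_neg hz
  have hφn : ∀ z ∉ K, ‖φ z‖ = (1 - ‖f z⁻¹‖) / ‖f z⁻¹‖ := fun z hz ↦ by
    simp only [φ]
    rw [norm_div, ← ofReal_one, ← ofReal_sub, norm_real,
      Real.norm_of_nonneg (by linarith [hfz1 z hz])]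
  have hφ0 : ∀ z ∉ K, φ z ≠ 0 := fun z hz ↦ by
    rw [← norm_pos_iff, hφn z hz]
    exact div_pos (sub_pos.mpr (hfz1 z hz)) (norm_pos_iff.mpr (hfz0 z hz))
  -- Properness of $f$ onto the disc: as $z$ approaches $K$, $1/z$ leaves each of these compact
  -- sets, so $|f(1/z)|\to1$ and $F\to0$.
  have hcompact : ∀ r < 1, IsCompact (U ∩ f ⁻¹' closedBall 0 r) := by
    intro r hr
    have hinv : ContinuousOn (Function.invFunOn f U) (ball 0 1) := by
      rw [_root_.continuousOn_iff']
      intro t ht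
      refine ⟨f '' (U ∩ t), isOpen_image_of_injOn hU h0U hc hf.differentiableOn hf.injOn _
        inter_subset_left (hU.inter ht), ?_⟩
      ext w
      refine and_congr_left fun hw ↦ ?_
      rw [← hfU] at hw
      obtain ⟨z, hz, rfl⟩ := hw
      have h1 : Function.invFunOn f U (f z) = z := hf.injOn.leftInvOn_invFunOn hz
      rw [mem_preimage, h1]
      constructor
      · exact fun h ↦ ⟨z, ⟨hz, h⟩, rfl⟩
      · rintro ⟨y, ⟨hy, hyt⟩, hyz⟩
        rwa [← hf.injOn hy hz hyz]
    have hsub : closedBall (0 : ℂ) r ⊆ ball 0 1 := closedBall_subset_ball hr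
    convert (isCompact_closedBall (0 : ℂ) r).image_of_continuousOn (hinv.mono hsub) using 1
    ext z
    constructor
    · exact fun hz ↦ ⟨f z, hz.2, hf.injOn.leftInvOn_invFunOn hz.1⟩
    · rintro ⟨w, hw, rfl⟩
      have hw' : w ∈ f '' U := hfU ▸ hsub hw
      exact ⟨Function.invFunOn_mem hw', by rwa [mem_preimage, Function.invFunOn_eq hw']⟩
  have hcont : Continuous F := by
    rw [continuous_iff_continuousAt]
    intro z
    by_cases hz : z ∈ K
    · rw [ContinuousAt, hFK z hz, tendsto_zero_iff_norm_tendsto_zero, Metric.tendsto_nhds]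
      intro ε hε
      -- The radius is chosen so that $(1-t)/t<\varepsilon$ exactly when $t>1/(1+\varepsilon)$, for
      -- $t>0$.
      have hr1 : 1 / (1 + ε) < 1 := by
        rw [div_lt_one (by positivity)]
        linarith
      set C := U ∩ f ⁻¹' closedBall 0 (1 / (1 + ε)) with hC
      have hCc : IsCompact C := hcompact _ hr1
      have hev : ∀ᶠ y in 𝓝 z, y⁻¹ ∉ C ∨ y = 0 := by
        by_cases h : z = 0
        · subst h
          filter_upwards [(isOpen_invCompl hCc).mem_nhds (Or.inl rfl)] with y hy
          exact hy.symm
        · have hzC : z⁻¹ ∉ C := fun hzC ↦ hzC.1.elim (fun h' ↦ h (inv_eq_zero.mp h'))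
            fun h' ↦ h' (by rwa [inv_inv])
          filter_upwards [(continuousAt_inv₀ h).preimage_mem_nhds
            (hCc.isClosed.isOpen_compl.mem_nhds hzC)] with y hy
          exact Or.inl hy
      filter_upwards [hev] with y hy
      rw [dist_zero_right, norm_norm]
      by_cases hyK : y ∈ K
      · rwa [hFK y hyK, norm_zero]
      · rw [hFφ y hyK, hφn y hyK]
        have hlt : 1 / (1 + ε) < ‖f y⁻¹‖ := by
          by_contra! hle
          exact hy.resolve_right (hz0 y hyK) ⟨hinvU y hyK, by simpa using hle⟩
        have hpos : 0 < ‖f y⁻¹‖ := norm_pos_iff.mpr (hfz0 y hyK)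
        rw [div_lt_iff₀ (by positivity)] at hlt
        rw [div_lt_iff₀ hpos]
        linarith
    · have hev : F =ᶠ[𝓝 z] φ := by
        filter_upwards [hK.isClosed.isOpen_compl.mem_nhds hz] with y hy using hFφ y hy
      refine ContinuousAt.congr ?_ hev.symm
      have hfc : ContinuousAt (fun y ↦ f y⁻¹) z :=
        ContinuousAt.comp (f := fun y : ℂ ↦ y⁻¹)
          (hf.differentiableOn.continuousOn.continuousAt (hU.mem_nhds (hinvU z hz)))
          (continuousAt_inv₀ (hz0 z hz))
      exact (continuousAt_const.sub (continuous_ofReal.continuousAt.comp hfc.norm)).div hfc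
        (hfz0 z hz)
  refine ⟨F, hcont, ?_, fun z w ↦ ?_⟩
  · rw [← tendsto_norm_atTop_iff_cobounded]
    have hKc : ∀ᶠ z in Bornology.cobounded ℂ, z ∉ K := hK.isBounded
    have hf0 : Tendsto (fun z ↦ ‖f z⁻¹‖) (Bornology.cobounded ℂ) (𝓝[>] 0) := by
      refine tendsto_nhdsWithin_iff.mpr ⟨?_, ?_⟩
      · have h1 : Tendsto f (𝓝 0) (𝓝 0) := by
          have := hf.differentiableOn.continuousOn.continuousAt (hU.mem_nhds h0U)
          rwa [ContinuousAt, hf.map_zero] at this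
        simpa using (h1.comp tendsto_inv₀_cobounded).norm
      · filter_upwards [hKc] with z hz using norm_pos_iff.mpr (hfz0 z hz)
    have hlim : Tendsto (fun z ↦ ‖f z⁻¹‖⁻¹ + (-1)) (Bornology.cobounded ℂ) atTop :=
      tendsto_atTop_add_const_right _ _ (tendsto_inv_nhdsGT_zero.comp hf0)
    refine hlim.congr' ?_
    filter_upwards [hKc] with z hz
    rw [hFφ z hz, hφn z hz]
    rw [sub_div, div_self (norm_ne_zero_iff.mpr (hfz0 z hz)), one_div, sub_eq_add_neg]
  · by_cases hz : z ∈ K <;> by_cases hw : w ∈ K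
    · simp [hFK z hz, hFK w hw, hz, hw]
    · have hzw : z ≠ w := fun h ↦ hw (h ▸ hz)
      simpa [hFK z hz, hFφ w hw, hw, hzw] using (hφ0 w hw).symm
    · have hzw : z ≠ w := fun h ↦ hz (h ▸ hw)
      simpa [hFφ z hz, hFK w hw, hz, hzw] using hφ0 z hz
    · simp only [hFφ z hz, hFφ w hw, hz, hw, and_false, or_false]
      refine ⟨fun h ↦ ?_, fun h ↦ h ▸ rfl⟩
      exact inv_injective (hf.injOn (hinvU z hz) (hinvU w hw) (one_sub_norm_div_injOn
        (hfz0 z hz) (hfz0 w hw) (hfz1 z hz) (hfz1 w hw) h))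

/-- An arc in the plane can be collapsed to a point by a proper map of the plane that is injective
elsewhere. -/
theorem exists_collapse {a b : ℂ} (γ : Path a b) (hγ : Function.Injective γ) :
    ∃ F : ℂ → ℂ, Continuous F ∧ Tendsto F (Bornology.cobounded ℂ) (Bornology.cobounded ℂ) ∧
      ∀ z w, F z = F w ↔ z = w ∨ z ∈ range γ ∧ w ∈ range γ := by
  have hcont : Continuous fun z : ℂ ↦ z - a := by fun_prop
  obtain ⟨F, hF, hFc, hFe⟩ := exists_collapse_of_zero_mem (γ.map hcont)
    (fun s t h ↦ hγ (sub_left_injective h)) ⟨0, by simp⟩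
  have hmem : ∀ z, z - a ∈ range (γ.map hcont) ↔ z ∈ range γ := fun z ↦
    ⟨fun ⟨t, ht⟩ ↦ ⟨t, sub_left_injective ht⟩, fun ⟨t, ht⟩ ↦ ⟨t, by simp [← ht]⟩⟩
  refine ⟨fun z ↦ F (z - a), hF.comp hcont, hFc.comp ?_, fun z w ↦ ?_⟩
  · exact (tendsto_sub_const_cobounded a)
  · rw [hFe, hmem, hmem, sub_left_inj]

/-! ### Drawings of minors by collapsing branch sets -/

namespace PlaneDrawing

variable {V W : Type*} {G : SimpleGraph V} {H : SimpleGraph W}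

/-- A proper map of the plane that collapses the drawings of the branch sets of a minor model to
distinct points and is injective elsewhere. -/
structure BranchCollapse (D : PlaneDrawing G) (φ : W → Set V) where
  /-- the map of the plane -/
  map : ℂ → ℂ
  /-- the set that is collapsed to the point of a vertex of the minor -/
  fiber : W → Set ℂ
  continuous_map : Continuous map
  tendsto_map : Tendsto map (Bornology.cobounded ℂ) (Bornology.cobounded ℂ)
  map_eq_iff : ∀ z w, map z = map w ↔ z = w ∨ ∃ x, z ∈ fiber x ∧ w ∈ fiber x
  disjoint_fiber : ∀ x y, x ≠ y → Disjoint (fiber x) (fiber y)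
  pos_mem_fiber : ∀ x, ∀ v ∈ φ x, D.pos v ∈ fiber x
  fiber_subset : ∀ x, fiber x ⊆ D.points (φ x)

/-- A choice of edges of `G` between the branch sets of a minor model of `H`. -/
structure EdgeLift (G : SimpleGraph V) (H : SimpleGraph W) (φ : W → Set V) where
  /-- the edge of `G` representing an edge of `H` -/
  lift : H.edgeSet → G.edgeSet
  exists_eq : ∀ (x y : W) (h : H.Adj x y), ∃ u ∈ φ x, ∃ v ∈ φ y,
    (lift ⟨s(x, y), h⟩ : Sym2 V) = s(u, v)

lemma nonempty_edgeLift {φ : W → Set V}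
    (hφ : ∀ x y, H.Adj x y → ∃ u ∈ φ x, ∃ v ∈ φ y, G.Adj u v) : Nonempty (EdgeLift G H φ) := by
  have key : ∀ e : H.edgeSet, ∃ f : G.edgeSet, ∀ x y, (e : Sym2 W) = s(x, y) →
      ∃ u ∈ φ x, ∃ v ∈ φ y, (f : Sym2 V) = s(u, v) := by
    rintro ⟨e, he⟩
    induction e with
    | _ x y =>
      obtain ⟨u, hu, v, hv, huv⟩ := hφ x y he
      refine ⟨⟨s(u, v), huv⟩, fun x' y' h ↦ ?_⟩
      rcases Sym2.eq_iff.mp h with ⟨rfl, rfl⟩ | ⟨rfl, rfl⟩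
      · exact ⟨u, hu, v, hv, rfl⟩
      · exact ⟨v, hv, u, hu, Sym2.eq_swap⟩
  choose f hf using key
  exact ⟨⟨f, fun x y h ↦ hf _ x y rfl⟩⟩

namespace BranchCollapse

variable {D : PlaneDrawing G} {φ : W → Set V} (C : BranchCollapse D φ) (L : EdgeLift G H φ)
include C

lemma eq_of_mem_fiber {x y : W} {z : ℂ} (hx : z ∈ C.fiber x) (hy : z ∈ C.fiber y) : x = y := by
  by_contra h
  exact Set.disjoint_left.mp (C.disjoint_fiber x y h) hx hy

lemma eq_of_mem {x y : W} {v : V} (hx : v ∈ φ x) (hy : v ∈ φ y) : x = y :=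
  C.eq_of_mem_fiber (C.pos_mem_fiber x v hx) (C.pos_mem_fiber y v hy)

lemma map_pos_eq {x : W} {u v : V} (hu : u ∈ φ x) (hv : v ∈ φ x) :
    C.map (D.pos u) = C.map (D.pos v) :=
  (C.map_eq_iff _ _).mpr (Or.inr ⟨x, C.pos_mem_fiber x u hu, C.pos_mem_fiber x v hv⟩)

omit C in
lemma exists_mem_of_mem_lift {e : H.edgeSet} {v : V} (hv : v ∈ (L.lift e : Sym2 V)) :
    ∃ x ∈ (e : Sym2 W), v ∈ φ x := by
  obtain ⟨e, he⟩ := e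
  induction e with
  | _ x y =>
    obtain ⟨a, ha, b, hb, hab⟩ := L.exists_eq x y he
    rw [hab, Sym2.mem_iff] at hv
    rcases hv with rfl | rfl
    · exact ⟨x, Sym2.mem_mk_left x y, ha⟩
    · exact ⟨y, Sym2.mem_mk_right x y, hb⟩

lemma mem_of_mem_lift {e : H.edgeSet} {x : W} {v : V} (hv : v ∈ (L.lift e : Sym2 V))
    (hx : v ∈ φ x) : x ∈ (e : Sym2 W) := by
  obtain ⟨y, hy, hvy⟩ := exists_mem_of_mem_lift L hv
  rwa [C.eq_of_mem hx hvy]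

lemma eq_of_mem_lift {e : H.edgeSet} {x : W} {u v : V} (hu : u ∈ (L.lift e : Sym2 V))
    (hv : v ∈ (L.lift e : Sym2 V)) (hux : u ∈ φ x) (hvx : v ∈ φ x) : u = v := by
  obtain ⟨e, he⟩ := e
  induction e with
  | _ y z =>
    obtain ⟨a, ha, b, hb, hab⟩ := L.exists_eq y z he
    have hyz : y ≠ z := H.ne_of_adj he
    rw [hab, Sym2.mem_iff] at hu hv
    rcases hu with rfl | rfl <;> rcases hv with rfl | rfl
    · rfl
    · exact absurd ((C.eq_of_mem ha hux).trans (C.eq_of_mem hvx hb)) hyz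
    · exact absurd ((C.eq_of_mem ha hvx).trans (C.eq_of_mem hux hb)) hyz
    · rfl

omit C in
lemma exists_mem_lift_of_mem {e : H.edgeSet} {x : W} (hx : x ∈ (e : Sym2 W)) :
    ∃ v ∈ (L.lift e : Sym2 V), v ∈ φ x := by
  obtain ⟨e, he⟩ := e
  induction e with
  | _ y z =>
    obtain ⟨a, ha, b, hb, hab⟩ := L.exists_eq y z he
    rw [hab]
    rcases Sym2.mem_iff.mp hx with rfl | rfl
    · exact ⟨a, Sym2.mem_mk_left a b, ha⟩
    · exact ⟨b, Sym2.mem_mk_right a b, hb⟩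

lemma lift_injective : Function.Injective L.lift := by
  have key : ∀ e f, L.lift e = L.lift f → ∀ x ∈ (e : Sym2 W), x ∈ (f : Sym2 W) := by
    intro e f h x hx
    obtain ⟨v, hv, hvx⟩ := exists_mem_lift_of_mem L hx
    rw [h] at hv
    exact C.mem_of_mem_lift L hv hvx
  exact fun e f h ↦ Subtype.ext (Sym2.ext fun x ↦ ⟨key e f h x, key f e h.symm x⟩)

/-- The arc of a lifted edge meets a fiber only in an end of the edge. -/
lemma exists_pos_eq_of_mem_arc {e : H.edgeSet} {x : W} {z : ℂ} (hz : z ∈ D.arc (L.lift e))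
    (hzx : z ∈ C.fiber x) : ∃ v ∈ (L.lift e : Sym2 V), v ∈ φ x ∧ z = D.pos v := by
  rcases C.fiber_subset x hzx with ⟨v, hv, rfl⟩ | h
  · exact ⟨v, D.vertex_mem_arc v _ hz, hv, rfl⟩
  · simp only [mem_iUnion] at h
    obtain ⟨f, hf, hzf⟩ := h
    -- A lifted edge joins two different branch sets, so it cannot lie inside one.
    have hne : L.lift e ≠ f := by
      rintro rfl
      obtain ⟨e, he⟩ := e
      induction e with
      | _ y z =>
        obtain ⟨a, ha, b, hb, hab⟩ := L.exists_eq y z he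
        refine H.ne_of_adj he ((C.eq_of_mem ha (hf a ?_)).trans (C.eq_of_mem (hf b ?_) hb))
        · rw [hab]
          exact Sym2.mem_mk_left a b
        · rw [hab]
          exact Sym2.mem_mk_right a b
    obtain ⟨w, hwe, hwf, hw⟩ := D.arc_inter _ _ hne z ⟨hz, hzf⟩
    exact ⟨w, hwe, hf w hwf, hw⟩

/-- The drawing of a minor obtained by collapsing the branch sets. -/
def drawing (r : W → V) (hr : ∀ x, r x ∈ φ x) : PlaneDrawing H where
  pos x := C.map (D.pos (r x))
  arc e := C.map '' D.arc (L.lift e)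
  pos_injective x y h := by
    rcases (C.map_eq_iff _ _).mp h with h | ⟨t, hx, hy⟩
    · exact C.eq_of_mem (hr x) (D.pos_injective h ▸ hr y)
    · exact (C.eq_of_mem_fiber (C.pos_mem_fiber x _ (hr x)) hx).trans
        (C.eq_of_mem_fiber hy (C.pos_mem_fiber y _ (hr y)))
  exists_path x y h := by
    obtain ⟨a, ha, b, hb, hab⟩ := L.exists_eq x y h
    have hadj : G.Adj a b := by
      have := (L.lift ⟨s(x, y), h⟩).2
      rwa [hab] at this
    obtain ⟨γ, hγ, hγr⟩ := D.exists_path a b hadj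
    have harc : range γ = D.arc (L.lift ⟨s(x, y), h⟩) := by
      rw [hγr]
      congr 1
      exact Subtype.ext hab.symm
    refine ⟨(γ.map C.continuous_map).cast (C.map_pos_eq (hr x) ha) (C.map_pos_eq (hr y) hb),
      fun s t hst ↦ ?_, ?_⟩
    · rcases (C.map_eq_iff _ _).mp hst with h | ⟨w, hs, ht⟩
      · exact hγ h
      · obtain ⟨c, hc, hcw, hcs⟩ := C.exists_pos_eq_of_mem_arc L (harc ▸ mem_range_self s) hs
        obtain ⟨d, hd, hdw, hdt⟩ := C.exists_pos_eq_of_mem_arc L (harc ▸ mem_range_self t) ht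
        rw [C.eq_of_mem_lift L hc hd hcw hdw, ← hdt] at hcs
        exact hγ hcs
    · rw [← harc, ← range_comp]
      rfl
  vertex_mem_arc x e := by
    rintro ⟨p, hp, hpx⟩
    rcases (C.map_eq_iff _ _).mp hpx with rfl | ⟨t, hpt, ht⟩
    · exact C.mem_of_mem_lift L (D.vertex_mem_arc _ _ hp) (hr x)
    · obtain rfl := C.eq_of_mem_fiber (C.pos_mem_fiber x _ (hr x)) ht
      obtain ⟨c, hc, hcx, -⟩ := C.exists_pos_eq_of_mem_arc L hp hpt
      exact C.mem_of_mem_lift L hc hcx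
  arc_inter e f hef := by
    rintro _ ⟨⟨p, hp, rfl⟩, ⟨q, hq, hqp⟩⟩
    rcases (C.map_eq_iff _ _).mp hqp with rfl | ⟨t, hqt, hpt⟩
    · obtain ⟨w, hwe, hwf, rfl⟩ :=
        D.arc_inter _ _ (fun h ↦ hef (C.lift_injective L h)) q ⟨hp, hq⟩
      obtain ⟨x, hx, hwx⟩ := exists_mem_of_mem_lift L hwe
      exact ⟨x, hx, C.mem_of_mem_lift L hwf hwx, C.map_pos_eq hwx (hr x)⟩
    · obtain ⟨c, hc, hct, rfl⟩ := C.exists_pos_eq_of_mem_arc L hp hpt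
      obtain ⟨d, hd, hdt, rfl⟩ := C.exists_pos_eq_of_mem_arc L hq hqt
      exact ⟨t, C.mem_of_mem_lift L hc hct, C.mem_of_mem_lift L hd hdt, C.map_pos_eq hct (hr t)⟩

variable {L} {r : W → V} {hr : ∀ x, r x ∈ φ x} {S : Set V} {T : Set W}

/-- Fibers lie in the drawings of their branch sets, so collapsing brings no point from outside the
old drawing into the new one; complements therefore map into complements. -/
lemma mem_points_of_map_mem_points (hT : ∀ x ∈ T, φ x ⊆ S) {z : ℂ}
    (hz : C.map z ∈ (C.drawing L r hr).points T) : z ∈ D.points S := by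
  have hmono : ∀ x ∈ T, C.fiber x ⊆ D.points S := by
    intro x hx p hp
    rcases C.fiber_subset x hp with ⟨v, hv, rfl⟩ | h
    · exact Or.inl ⟨v, hT x hx hv, rfl⟩
    · simp only [mem_iUnion] at h
      obtain ⟨f, hf, hpf⟩ := h
      exact Or.inr (mem_iUnion₂.mpr ⟨f, fun w hw ↦ hT x hx (hf w hw), hpf⟩)
  rcases hz with ⟨x, hx, hxz⟩ | h
  · have hfib := C.pos_mem_fiber x _ (hr x)
    rcases (C.map_eq_iff _ _).mp hxz with rfl | ⟨t, ht, hzt⟩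
    · exact hmono x hx hfib
    · obtain rfl := C.eq_of_mem_fiber hfib ht
      exact hmono x hx hzt
  · simp only [mem_iUnion] at h
    obtain ⟨e, he, p, hp, hpz⟩ := h
    rcases (C.map_eq_iff _ _).mp hpz with rfl | ⟨t, ht, hzt⟩
    · refine Or.inr (mem_iUnion₂.mpr ⟨L.lift e, fun w hw ↦ ?_, hp⟩)
      obtain ⟨x, hx, hwx⟩ := exists_mem_of_mem_lift L hw
      exact hT x (he x hx) hwx
    · obtain ⟨c, hc, hct, -⟩ := C.exists_pos_eq_of_mem_arc L hp ht
      exact hmono t (he t (C.mem_of_mem_lift L hc hct)) hzt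

/-- The image of the unbounded component is connected and avoids the new drawing; properness keeps
it unbounded. -/
lemma map_mem_exteriorFace (hT : ∀ x ∈ T, φ x ⊆ S) {z : ℂ} (hz : z ∈ exteriorFace (D.points S)) :
    C.map z ∈ exteriorFace ((C.drawing L r hr).points T) := by
  refine ⟨fun h ↦ hz.1 (C.mem_points_of_map_mem_points hT h), fun hbd ↦ hz.2 ?_⟩
  have hsub : C.map '' connectedComponentIn (D.points S)ᶜ z ⊆
      connectedComponentIn ((C.drawing L r hr).points T)ᶜ (C.map z) := by
    refine (isPreconnected_connectedComponentIn.image _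
      C.continuous_map.continuousOn).subset_connectedComponentIn
      (mem_image_of_mem _ (mem_connectedComponentIn hz.1)) ?_
    rintro _ ⟨p, hp, rfl⟩ h
    exact connectedComponentIn_subset _ _ hp (C.mem_points_of_map_mem_points hT h)
  have h1 : C.map ⁻¹' (connectedComponentIn ((C.drawing L r hr).points T)ᶜ (C.map z))ᶜ ∈
      Bornology.cobounded ℂ :=
    C.tendsto_map (Bornology.isBounded_def.mp hbd)
  rw [← preimage_compl.symm] at h1
  exact (Bornology.isBounded_def.mpr h1).subset (image_subset_iff.mp hsub)

lemma mem_exteriorVertices (hT : ∀ x ∈ T, φ x ⊆ S) {x : W} {v : V} (hx : x ∈ T) (hv : v ∈ φ x)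
    (hvS : v ∈ D.exteriorVertices S) : x ∈ (C.drawing L r hr).exteriorVertices T := by
  refine ⟨hx, ?_⟩
  change C.map (D.pos (r x)) ∈ _
  rw [C.map_pos_eq (hr x) hv]
  exact map_mem_closure C.continuous_map hvS.2 fun z hz ↦ C.map_mem_exteriorFace hT hz

/-- The inclusion of branch sets in $S$ survives each peeling: if a branch set loses a vertex, its
vertex of $H$ is removed too. General $S$ and $T$ are needed since $T$ may shrink faster. -/
lemma isKOuterplanarOn (k : ℕ) (hT : ∀ x ∈ T, φ x ⊆ S) (hD : D.IsKOuterplanarOn k S) :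
    (C.drawing L r hr).IsKOuterplanarOn k T := by
  induction k generalizing S T with
  | zero =>
    rw [IsKOuterplanarOn] at hD ⊢
    subst hD
    exact eq_empty_of_forall_notMem fun x hx ↦ hT x hx (hr x)
  | succ k ih =>
    rw [IsKOuterplanarOn] at hD ⊢
    exact ih (S := S \ D.exteriorVertices S) (fun x hx v hv ↦ ⟨hT x hx.1 hv, fun h ↦
      hx.2 (C.mem_exteriorVertices hT hx.1 hv h)⟩) hD

lemma isKOuterplanar (hne : ∀ x, (φ x).Nonempty)
    (hadj : ∀ x y, H.Adj x y → ∃ u ∈ φ x, ∃ v ∈ φ y, G.Adj u v) {k : ℕ}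
    (hD : D.IsKOuterplanar k) : H.IsKOuterplanar k := by
  obtain ⟨L⟩ := nonempty_edgeLift hadj
  choose r hr using hne
  exact ⟨C.drawing L r hr, C.isKOuterplanarOn k (fun _ _ ↦ subset_univ _) hD⟩

end BranchCollapse

/-- The trivial collapse for a minor model with singleton branch sets. -/
def BranchCollapse.ofInjective (D : PlaneDrawing G) {f : W → V} (hf : Function.Injective f) :
    BranchCollapse D (fun x ↦ {f x}) where
  map := id
  fiber x := {D.pos (f x)}
  continuous_map := continuous_id
  tendsto_map := tendsto_id
  map_eq_iff z w := by
    refine ⟨Or.inl, ?_⟩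
    rintro (h | ⟨x, rfl, rfl⟩)
    · exact h
    · rfl
  disjoint_fiber x y hxy := by
    rw [disjoint_singleton]
    exact fun h ↦ hxy (hf (D.pos_injective h))
  pos_mem_fiber := by
    rintro x v rfl
    rfl
  fiber_subset := by
    rintro x _ rfl
    exact Or.inl ⟨f x, rfl, rfl⟩

end PlaneDrawing

/-! ### Contracting one edge and the induction -/

namespace SimpleGraph

variable {V : Type*} (G : SimpleGraph V)

/-- The branch sets of the contraction of an edge `uv`, with `v` merged into `u`. -/
def contractBranch (u v : V) (w : {w : V // w ≠ v}) : Set V :=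
  {p | p = w ∨ (w : V) = u ∧ p = v}

/-- The graph obtained by contracting the edge `uv`. -/
def contract (u v : V) : SimpleGraph {w : V // w ≠ v} where
  Adj x y := x ≠ y ∧ ∃ p ∈ contractBranch u v x, ∃ q ∈ contractBranch u v y, G.Adj p q
  symm := ⟨fun _ _ ⟨hxy, p, hp, q, hq, h⟩ ↦ ⟨hxy.symm, q, hq, p, hp, h.symm⟩⟩
  loopless := ⟨fun _ h ↦ h.1 rfl⟩

/-- The only nontrivial fiber is the arc of $uv$. It contains no third vertex, so it is disjoint
from the other fibers. -/
lemma IsKOuterplanar.contract {G : SimpleGraph V} {k : ℕ} (hG : G.IsKOuterplanar k) {u v : V}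
    (huv : G.Adj u v) : (G.contract u v).IsKOuterplanar k := by
  obtain ⟨D, hD⟩ := hG
  obtain ⟨γ, hγ, hγr⟩ := D.exists_path u v huv
  obtain ⟨F, hF, hFc, hFe⟩ := exists_collapse γ hγ
  have hu : D.pos u ∈ range γ := ⟨0, γ.source⟩
  have hv : D.pos v ∈ range γ := ⟨1, γ.target⟩
  have hend : ∀ w, D.pos w ∈ range γ → w = u ∨ w = v := fun w hw ↦ by
    rw [hγr] at hw
    exact Sym2.mem_iff.mp (D.vertex_mem_arc w _ hw)
  let C : D.BranchCollapse (contractBranch u v) :=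
    { map := F
      fiber := fun w ↦ {z | z = D.pos w ∨ (w : V) = u ∧ z ∈ range γ}
      continuous_map := hF
      tendsto_map := hFc
      map_eq_iff := by
        intro z w
        rw [hFe]
        constructor
        · rintro (h | ⟨hz, hw⟩)
          · exact Or.inl h
          · exact Or.inr ⟨⟨u, G.ne_of_adj huv⟩, Or.inr ⟨rfl, hz⟩, Or.inr ⟨rfl, hw⟩⟩
        · rintro (h | ⟨x, rfl | ⟨hx, hz⟩, rfl | ⟨hx', hw⟩⟩)
          · exact Or.inl h
          · exact Or.inl rfl
          · exact Or.inr ⟨hx' ▸ hu, hw⟩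
          · exact Or.inr ⟨hz, hx ▸ hu⟩
          · exact Or.inr ⟨hz, hw⟩
      disjoint_fiber := by
        intro x y hxy
        rw [Set.disjoint_left]
        rintro z (rfl | ⟨hx, hz⟩) (hz' | ⟨hy, hz'⟩)
        · exact hxy (Subtype.ext (D.pos_injective hz'))
        · exact hxy (Subtype.ext (((hend _ hz').resolve_right x.2).trans hy.symm))
        · subst hz'
          exact hxy (Subtype.ext (hx.trans ((hend _ hz).resolve_right y.2).symm))
        · exact hxy (Subtype.ext (hx.trans hy.symm))
      pos_mem_fiber := by
        rintro x p (rfl | ⟨hx, rfl⟩)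
        · exact Or.inl rfl
        · exact Or.inr ⟨hx, hv⟩
      fiber_subset := by
        rintro x z (rfl | ⟨hx, hz⟩)
        · exact Or.inl ⟨x, Or.inl rfl, rfl⟩
        · rw [hγr] at hz
          refine Or.inr (Set.mem_iUnion₂.mpr ⟨_, fun w hw ↦ ?_, hz⟩)
          rcases Sym2.mem_iff.mp hw with rfl | rfl
          · exact Or.inl hx.symm
          · exact Or.inr ⟨hx, rfl⟩ }
  exact C.isKOuterplanar (H := G.contract u v) (fun x ↦ ⟨x, Or.inl rfl⟩) (fun _ _ h ↦ h.2) hD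

/-- A minor model with an edge `uv` inside a branch set induces a minor model in the contraction. -/
lemma isMinorOf_contract {W : Type*} {H : SimpleGraph W} {G : SimpleGraph V} {φ : W → Set V}
    (hconn : ∀ x, (G.induce (φ x)).Connected) (hdisj : ∀ x y, x ≠ y → Disjoint (φ x) (φ y))
    (hadj : ∀ x y, H.Adj x y → ∃ u ∈ φ x, ∃ v ∈ φ y, G.Adj u v) {t : W} {u v : V}
    (hu : u ∈ φ t) (hv : v ∈ φ t) (huv : G.Adj u v) : H.IsMinorOf (G.contract u v) := by
  classical
  have heq : ∀ x p, p ∈ φ x → p = v → x = t := fun x p hp hpv ↦ by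
    by_contra h
    exact Set.disjoint_left.mp (hdisj x t h) hp (hpv ▸ hv)
  -- This retraction sends $v$ to $u$. It preserves every branch set because $u$ and $v$ share one,
  -- and it turns walks into walks with steps possibly dropped.
  let c : V → {w : V // w ≠ v} := fun p ↦ if h : p = v then ⟨u, G.ne_of_adj huv⟩ else ⟨p, h⟩
  have hcv : c v = ⟨u, G.ne_of_adj huv⟩ := dif_pos rfl
  have hcne : ∀ p (h : p ≠ v), c p = ⟨p, h⟩ := fun p h ↦ dif_neg h
  have hcb : ∀ p, p ∈ contractBranch u v (c p) := fun p ↦ by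
    by_cases h : p = v
    · subst h
      rw [hcv]
      exact Or.inr ⟨rfl, rfl⟩
    · rw [hcne p h]
      exact Or.inl rfl
  have hcφ : ∀ x p, p ∈ φ x → (c p : V) ∈ φ x := fun x p hp ↦ by
    by_cases h : p = v
    · rw [heq x p hp h, h, hcv]
      exact hu
    · rw [hcne p h]
      exact hp
  have hcadj : ∀ p q, G.Adj p q → c p ≠ c q → (G.contract u v).Adj (c p) (c q) :=
    fun p q h hne ↦ ⟨hne, p, hcb p, q, hcb q, h⟩
  refine ⟨fun x ↦ {w | (w : V) ∈ φ x}, fun x ↦ ?_, fun x y hxy ↦ ?_, fun x y hxy ↦ ?_⟩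
  · have hreach : ∀ p q : φ x, (G.induce (φ x)).Reachable p q →
        ((G.contract u v).induce {w : {w : V // w ≠ v} | (w : V) ∈ φ x}).Reachable
          ⟨c p, hcφ x p p.2⟩ ⟨c q, hcφ x q q.2⟩ := by
      rintro p q ⟨w⟩
      induction w with
      | nil => exact Reachable.refl _
      | @cons a b d hab _ ih =>
        refine Reachable.trans ?_ ih
        by_cases h : c a = c b
        · simp only [h]
          exact Reachable.refl _
        · exact Adj.reachable (hcadj a b hab h)
    have hne : Nonempty {w : {w : V // w ≠ v} | (w : V) ∈ φ x} := by
      obtain ⟨p⟩ := (hconn x).nonempty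
      exact ⟨⟨c p, hcφ x p p.2⟩⟩
    refine ⟨fun a b ↦ ?_⟩
    have hab := hreach ⟨a.1, a.2⟩ ⟨b.1, b.2⟩ ((hconn x).preconnected _ _)
    simpa only [hcne _ a.1.2, hcne _ b.1.2] using hab
  · exact Set.disjoint_left.mpr fun w hwx hwy ↦ Set.disjoint_left.mp (hdisj x y hxy) hwx hwy
  · obtain ⟨p, hp, q, hq, hpq⟩ := hadj x y hxy
    refine ⟨c p, hcφ x p hp, c q, hcφ y q hq, hcadj p q hpq fun h ↦ ?_⟩
    exact Set.disjoint_left.mp (hdisj x y (H.ne_of_adj hxy)) (hcφ x p hp) (h ▸ hcφ y q hq)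

lemma exists_adj_of_induce_connected {G : SimpleGraph V} {S : Set V}
    (h : (G.induce S).Connected) {a b : V} (ha : a ∈ S) (hb : b ∈ S) (hab : a ≠ b) :
    ∃ u ∈ S, ∃ v ∈ S, G.Adj u v := by
  obtain ⟨w⟩ := h.preconnected ⟨a, ha⟩ ⟨b, hb⟩
  cases w with
  | nil => exact absurd rfl hab
  | @cons _ c _ hadj _ => exact ⟨a, ha, c, c.2, hadj⟩

end SimpleGraph

theorem lemma2p10 {V W : Type*} [Finite V] (G : SimpleGraph V) (H : SimpleGraph W) (k : ℕ)
    (hG : G.IsKOuterplanar k) (hHG : H.IsMinorOf G) : H.IsKOuterplanar k := by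
  induction hn : Nat.card V using Nat.strong_induction_on generalizing V with
  | _ n ih =>
    obtain ⟨φ, hconn, hdisj, hadj⟩ := hHG
    by_cases hedge : ∃ t, ∃ u ∈ φ t, ∃ v ∈ φ t, G.Adj u v
    · obtain ⟨t, u, hu, v, hv, huv⟩ := hedge
      refine ih _ ?_ (G.contract u v) (hG.contract huv)
        (SimpleGraph.isMinorOf_contract hconn hdisj hadj hu hv huv) rfl
      rw [← hn]
      exact Finite.card_subtype_lt (x := v) (fun h ↦ h rfl)
    -- Connected branch sets without edges are singletons, so the identity map of the plane serves
    -- as the collapse.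
    · have hne : ∀ x, (φ x).Nonempty := fun x ↦ by
        obtain ⟨p⟩ := (hconn x).nonempty
        exact ⟨p, p.2⟩
      choose f hf using hne
      have hφ : φ = fun x ↦ {f x} := by
        funext x
        refine subset_antisymm (fun p hp ↦ ?_) (singleton_subset_iff.mpr (hf x))
        by_contra hpf
        obtain ⟨u, hu, v, hv, huv⟩ :=
          SimpleGraph.exists_adj_of_induce_connected (hconn x) hp (hf x) hpf
        exact hedge ⟨x, u, hu, v, hv, huv⟩
      have hfinj : Function.Injective f := fun x y hxy ↦ by
        by_contra h
        exact Set.disjoint_left.mp (hdisj x y h) (hf x) (hxy ▸ hf y)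
      subst hφ
      obtain ⟨D, hD⟩ := hG
      exact (PlaneDrawing.BranchCollapse.ofInjective D hfinj).isKOuterplanar
        (fun x ↦ singleton_nonempty _) hadj hD
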